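/- Let $d\ge 1$, let $G=(V,E)$ be a finite simple graph with $|V|\ge d+1$ and let $p:V\to\mathbb R^d$. For $u,v\in V$ put $d_{uv}=\frac{p(u)-p(v)}{\|p(u)-p(v)\|}$ if $p(u)\ne p(v)$ and $d_{uv}=0$ otherwise. Let $R(G,p)\in\mathbb R^{d|V|\times|E|}$ be the matrix whose columns are the vectors $(1_u-1_v)\otimes d_{uv}$ for $\{u,v\}\in E$, where $\{1_u\}_{u\in V}$ is the standard basis of $\mathbb R^{V}$, and let $L(G,p)=R(G,p)R(G,p)^T$. The $d$-dimensional algebraic connectivity of $G$ is $$a_d(G)=\sup\left\{\lambda_{\binom{d+1}{2}+1}(L(G,p))\right\},$$ where $\lambda_i(A)$ is the $i$-th smallest eigenvalue of a symmetric matrix $A$ (counted with multiplicity) and the supremum is over all maps $p:V\to\mathbb R^d$ whose image does not lie on an affine hyperplane. For $n\ge d+1$, the generalized path $P_{n,d}$ is the graph on vertex set $[n]=\{1,\dots,n\}$ with edges $\{i,j\}$ for all $1\le i<j\le n$ with $j-i\le d$. **Proposition.** Let $d\ge 2$ and $n\ge d+1$. Then $$1-\cos\left(\frac{\pi}{2}\left\lceil\frac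 nd\right\rceil^{-1}\right)\ \le\ a_d(P_{n,d})\ \le\ 2d-2\sum_{k=1}^d\cos\left(\frac{2k\pi}{n}\right).$$ For $d=2$ and every $n\ge 3$, moreover, $a_2(P_{n,2})\ge 2\left(1-\cos(\pi/n)\right)$. Consequently $a_d(P_{n,d})=\Theta_d(1/n^2)$: for every $d\ge 2$ there are constants $c,C>0$, depending only on $d$, such that $\frac{c}{n^2}\le a_d(P_{n,d})\le\frac{C}{n^2}$ for all $n\ge d+1$. -/

import Mathlib

noncomputable section

/-- The `i`-th smallest eigenvalue (`i = 1, …, N`, counted with multiplicity) of a real symmetric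
`N × N` matrix. Mathlib's `eigenvalues₀` lists the eigenvalues in decreasing order starting at
index `0`, so this is its entry `N - i`. Outside the range `1 ≤ i ≤ N` the value is `0`. -/
def smallestEigenvalue {ι : Type*} [Fintype ι] [DecidableEq ι] {A : Matrix ι ι ℝ}
    (hA : A.IsHermitian) (i : ℕ) : ℝ :=
  if h : 1 ≤ i ∧ i ≤ Fintype.card ι then
    hA.eigenvalues₀ ⟨Fintype.card ι - i, by omega⟩
  else 0

open Classical in
/-- The unit vector `d_{uv}` from `p v` to `p u`, or `0` if the two points coincide. -/
def frameworkDirection {V : Type*} {d : ℕ} (p : V → EuclideanSpace ℝ (Fin d)) (u v : V) :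
    EuclideanSpace ℝ (Fin d) :=
  if p u ≠ p v then ‖p u - p v‖⁻¹ • (p u - p v) else 0

theorem frameworkDirection_swap {V : Type*} {d : ℕ} (p : V → EuclideanSpace ℝ (Fin d)) (u v : V) :
    frameworkDirection p v u = -frameworkDirection p u v := by
  unfold frameworkDirection
  by_cases h : p u = p v
  · simp [h]
  · rw [if_pos (Ne.symm h), if_pos h, norm_sub_rev, ← smul_neg, neg_sub]

/-- The vector `(1_u - 1_v) ⊗ d_{uv}`, with coordinates indexed by `V × Fin d`. -/
def edgeVector {V : Type*} [DecidableEq V] {d : ℕ} (p : V → EuclideanSpace ℝ (Fin d)) (u v : V) :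
    V × Fin d → ℝ :=
  fun x => ((Pi.single u 1 - Pi.single v 1 : V → ℝ) x.1) * frameworkDirection p u v x.2

theorem edgeVector_swap {V : Type*} [DecidableEq V] {d : ℕ} (p : V → EuclideanSpace ℝ (Fin d))
    (u v : V) : edgeVector p u v = edgeVector p v u := by
  funext x
  simp only [edgeVector, frameworkDirection_swap p u v, Pi.sub_apply, PiLp.neg_apply]
  ring

/-- The normalized rigidity matrix `R(G, p)`: its columns are the vectors `(1_u - 1_v) ⊗ d_{uv}`
for the edges `{u, v}` of `G`. -/
def rigidityMatrix {V : Type*} [DecidableEq V] (G : SimpleGraph V) {d : ℕ}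
    (p : V → EuclideanSpace ℝ (Fin d)) : Matrix (V × Fin d) G.edgeSet ℝ :=
  fun x e => Sym2.lift ⟨edgeVector p, edgeVector_swap p⟩ e.1 x

/-- The stiffness matrix `L(G, p) = R(G, p) R(G, p)ᵀ`. -/
def stiffnessMatrix {V : Type*} [Fintype V] [DecidableEq V] (G : SimpleGraph V)
    [DecidableRel G.Adj] {d : ℕ} (p : V → EuclideanSpace ℝ (Fin d)) :
    Matrix (V × Fin d) (V × Fin d) ℝ :=
  rigidityMatrix G p * (rigidityMatrix G p).transpose

theorem stiffnessMatrix_isHermitian {V : Type*} [Fintype V] [DecidableEq V] (G : SimpleGraph V)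
    [DecidableRel G.Adj] {d : ℕ} (p : V → EuclideanSpace ℝ (Fin d)) :
    (stiffnessMatrix G p).IsHermitian := by
  simpa [stiffnessMatrix, Matrix.conjTranspose_eq_transpose_of_trivial] using
    Matrix.isHermitian_mul_conjTranspose_self (rigidityMatrix G p)

/-- The `d`-dimensional algebraic connectivity of `G`: the supremum of the
`(binom (d+1) 2 + 1)`-th smallest eigenvalue of `L(G, p)` over all maps `p : V → ℝ^d` whose image
does not lie on an affine hyperplane, that is, whose image affinely spans `ℝ^d`. -/
def algebraicConnectivity {V : Type*} [Fintype V] [DecidableEq V] (d : ℕ) (G : SimpleGraph V)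
    [DecidableRel G.Adj] : ℝ :=
  sSup {x : ℝ | ∃ p : V → EuclideanSpace ℝ (Fin d),
    affineSpan ℝ (Set.range p) = ⊤ ∧
    x = smallestEigenvalue (stiffnessMatrix_isHermitian G p) ((d + 1).choose 2 + 1)}

/-- The generalized path `P_{n,d}` on `n` vertices: `i` and `j` with `i < j` are adjacent
exactly when `j - i ≤ d`. -/
def generalizedPath (n d : ℕ) : SimpleGraph (Fin n) where
  Adj i j := (i < j ∧ (j : ℕ) - (i : ℕ) ≤ d) ∨ (j < i ∧ (i : ℕ) - (j : ℕ) ≤ d)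
  symm := ⟨fun _ _ h => h.symm⟩
  loopless := ⟨fun i h => by simp at h⟩

instance generalizedPath_decidableAdj (n d : ℕ) : DecidableRel (generalizedPath n d).Adj :=
  fun i j => inferInstanceAs
    (Decidable ((i < j ∧ (j : ℕ) - (i : ℕ) ≤ d) ∨ (j < i ∧ (i : ℕ) - (j : ℕ) ≤ d)))

end

open Matrix

/-! ### Variational bounds for eigenvalues -/

/-! Both bounds are Courant–Fischer arguments built around the number `binom (d+1) 2`, which is the
cardinality of `Sym2 (Fin d)`.

Upper bound. For every spanning `p` the translations and infinitesimal rotations form a space of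
dimension `binom (d+1) 2` in the kernel of `L(G, p)`. Given `f : V → ℝ` with sum zero, let `w` be
the moment `∑ f(u) p(u)`, or any nonzero vector if the moment vanishes. Then `f ⊗ w` is orthogonal
to all trivial motions, since a skew form vanishes at `(w, w)`, and its Rayleigh quotient is at most
the graph Laplacian quotient of `f`. Taking `f` to be a cosine or sine of period `n` gives the
stated sum (`smallestEigenvalue_stiffnessMatrix_le`, `exists_test_function`).

Lower bound. Place `u` at `e_{u mod d} + ε u (1, …, 1)`. As `ε → 0⁺`, an edge inside a residue class
gets direction `-(1, …, 1)/√d`, and an edge between classes `i` and `j` gets `(e_i - e_j)/√2`. The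
limit form therefore decouples into path energies: of the coordinate sum along each class, and of
`x_i - x_j` along the union of the classes `i` and `j`, whose consecutive elements alternate in
class and are at most `d` apart. One mean-zero condition per class and per pair of classes makes
`binom (d+1) 2` conditions, under which the sharp path Poincaré inequality applies (`path_poincare`,
`directionForm_limit_ge`). By continuity a small `ε > 0` loses arbitrarily little
(`exists_pos_directionForm_ge`). -/

theorem exists_eigenCoordinates {ι : Type*} [Fintype ι] [DecidableEq ι] {A : Matrix ι ι ℝ}
    (hA : A.IsHermitian) :
    ∃ ℓ : Fin (Fintype.card ι) → ((ι → ℝ) →ₗ[ℝ] ℝ), ∀ x : ι → ℝ,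
      x ⬝ᵥ x = ∑ j, ℓ j x ^ 2 ∧ x ⬝ᵥ A *ᵥ x = ∑ j, hA.eigenvalues₀ j * ℓ j x ^ 2 := by
  set e : Fin (Fintype.card ι) ≃ ι := Fintype.equivOfCardEq (Fintype.card_fin _) with he
  let b := hA.eigenvectorBasis
  have hin : ∀ (i : ι) (y : ι → ℝ), inner ℝ (b i) (WithLp.toLp 2 y) = (b i : ι → ℝ) ⬝ᵥ y := by
    intro i y
    simp [EuclideanSpace.inner_eq_star_dotProduct, dotProduct_comm]
  have hexp : ∀ x y : ι → ℝ, x ⬝ᵥ y = ∑ i, ((b i : ι → ℝ) ⬝ᵥ x) * ((b i : ι → ℝ) ⬝ᵥ y) := by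
    intro x y
    have h := b.sum_inner_mul_inner (WithLp.toLp 2 x) (WithLp.toLp 2 y)
    have h2 : inner ℝ (WithLp.toLp 2 x) (WithLp.toLp 2 y) = x ⬝ᵥ y := by
      simp [EuclideanSpace.inner_eq_star_dotProduct, dotProduct_comm]
    rw [← h2, ← h]
    refine Finset.sum_congr rfl fun i _ => ?_
    rw [hin, real_inner_comm, hin]
  refine ⟨fun j => dotProductBilin ℝ ℝ (b (e j) : ι → ℝ), fun x => ⟨?_, ?_⟩⟩
  · rw [hexp x x, ← e.sum_comp]
    exact Finset.sum_congr rfl fun j _ => (sq _).symm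
  · rw [hexp x, ← e.sum_comp]
    refine Finset.sum_congr rfl fun j _ => ?_
    have h1 : (b (e j) : ι → ℝ) ⬝ᵥ A *ᵥ x = hA.eigenvalues₀ j * ((b (e j) : ι → ℝ) ⬝ᵥ x) := by
      rw [dotProduct_mulVec, ← mulVec_transpose]
      have : Aᵀ = A := by simpa [IsHermitian, conjTranspose_eq_transpose_of_trivial] using hA
      rw [this, hA.mulVec_eigenvectorBasis, smul_dotProduct, smul_eq_mul]
      congr 1
      simp [IsHermitian.eigenvalues, he]
    rw [h1]
    simp only [dotProductBilin_apply_apply]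
    ring

/-- A space of dimension `k + 1` contains a nonzero vector on which the coordinates of the `k`
smallest eigenvalues, the last `k` in Mathlib's decreasing order, all vanish. -/
theorem smallestEigenvalue_le_of_injective {ι : Type*} [Fintype ι] [DecidableEq ι]
    {A : Matrix ι ι ℝ} (hA : A.IsHermitian) {k : ℕ} {a : ℝ} {M : Type*} [AddCommGroup M]
    [Module ℝ M] [FiniteDimensional ℝ M] (hM : Module.finrank ℝ M = k + 1)
    (T : M →ₗ[ℝ] (ι → ℝ)) (hT : Function.Injective T)
    (h : ∀ m, T m ⬝ᵥ A *ᵥ T m ≤ a * (T m ⬝ᵥ T m)) :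
    smallestEigenvalue hA (k + 1) ≤ a := by
  have hk : k + 1 ≤ Fintype.card ι := by
    rw [← hM, ← Module.finrank_fintype_fun_eq_card ℝ]
    exact LinearMap.finrank_le_finrank_of_injective hT
  obtain ⟨ℓ, hℓ⟩ := exists_eigenCoordinates hA
  rw [smallestEigenvalue, dif_pos ⟨by omega, hk⟩]
  let g : M →ₗ[ℝ] (Fin k → ℝ) :=
    LinearMap.pi fun j => (ℓ ⟨Fintype.card ι - k + j, by omega⟩).comp T
  obtain ⟨m, hm, hm0⟩ := (Submodule.ne_bot_iff _).1
    (LinearMap.ker_ne_bot_of_finrank_lt (f := g) (by simp [hM]))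
  have hz : ∀ j : Fin (Fintype.card ι), Fintype.card ι - (k + 1) < j → ℓ j (T m) = 0 := by
    intro j hj
    have h1 := congrFun (LinearMap.mem_ker.1 hm) ⟨j - (Fintype.card ι - k), by omega⟩
    simp only [g, LinearMap.pi_apply, LinearMap.comp_apply, Pi.zero_apply] at h1
    have e : (⟨Fintype.card ι - k + (j - (Fintype.card ι - k)), by omega⟩ :
        Fin (Fintype.card ι)) = j := by ext; dsimp only; omega
    rwa [e] at h1
  have hpos : 0 < T m ⬝ᵥ T m := by
    have : T m ≠ 0 := fun h0 => hm0 (hT (by simpa using h0))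
    have h2 := dotProduct_self_star_pos_iff (v := T m)
    simpa using h2.2 this
  refine le_of_mul_le_mul_right (le_trans ?_ (h m)) hpos
  rw [(hℓ _).1, (hℓ _).2, Finset.mul_sum]
  refine Finset.sum_le_sum fun j _ => ?_
  by_cases hj : Fintype.card ι - (k + 1) < j
  · rw [hz j hj]; simp
  · exact mul_le_mul_of_nonneg_right (hA.eigenvalues₀_antitone (by
      rw [Fin.le_def]; dsimp only; omega)) (sq_nonneg _)

/-- The `k` constraints and the coordinates of all but the `k + 1` smallest eigenvalues are one
functional short of the full dimension, so they have a common nonzero zero. -/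
theorem le_smallestEigenvalue_of_constraints {ι : Type*} [Fintype ι] [DecidableEq ι]
    {A : Matrix ι ι ℝ} (hA : A.IsHermitian) {k : ℕ} (hk : k + 1 ≤ Fintype.card ι) {a : ℝ}
    {K : Type*} [Fintype K] (hK : Fintype.card K = k)
    (f : (ι → ℝ) →ₗ[ℝ] (K → ℝ)) (h : ∀ x, f x = 0 → a * (x ⬝ᵥ x) ≤ x ⬝ᵥ A *ᵥ x) :
    a ≤ smallestEigenvalue hA (k + 1) := by
  obtain ⟨ℓ, hℓ⟩ := exists_eigenCoordinates hA
  rw [smallestEigenvalue, dif_pos ⟨by omega, hk⟩]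
  let g : (ι → ℝ) →ₗ[ℝ] ((K → ℝ) × (Fin (Fintype.card ι - (k + 1)) → ℝ)) :=
    f.prod (LinearMap.pi fun j => ℓ ⟨j, by omega⟩)
  obtain ⟨x, hx, hx0⟩ := (Submodule.ne_bot_iff _).1
    (LinearMap.ker_ne_bot_of_finrank_lt (f := g) (by simp [hK]; omega))
  have hx := LinearMap.mem_ker.1 hx
  have hf : f x = 0 := congrArg Prod.fst hx
  have hz : ∀ j : Fin (Fintype.card ι), j < Fintype.card ι - (k + 1) → ℓ j x = 0 := fun j hj =>
    congrFun (congrArg Prod.snd hx) ⟨j, hj⟩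
  have hpos : 0 < x ⬝ᵥ x := by
    have h2 := dotProduct_self_star_pos_iff (v := x)
    simpa using h2.2 hx0
  refine le_of_mul_le_mul_right ((h x hf).trans ?_) hpos
  rw [(hℓ _).1, (hℓ _).2, Finset.mul_sum]
  refine Finset.sum_le_sum fun j _ => ?_
  by_cases hj : j < Fintype.card ι - (k + 1)
  · rw [hz j hj]; simp
  · exact mul_le_mul_of_nonneg_right (hA.eigenvalues₀_antitone (by
      rw [Fin.le_def]; dsimp only; omega)) (sq_nonneg _)

/-! ### The quadratic form of the stiffness matrix -/

theorem rigidityMatrix_transpose_mulVec {V : Type*} [Fintype V] [DecidableEq V]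
    (G : SimpleGraph V) {d : ℕ} (p : V → EuclideanSpace ℝ (Fin d)) (x : V × Fin d → ℝ)
    {u v : V} (h : s(u, v) ∈ G.edgeSet) :
    ((rigidityMatrix G p)ᵀ *ᵥ x) ⟨s(u, v), h⟩ =
      ∑ c, frameworkDirection p u v c * (x (u, c) - x (v, c)) := by
  simp only [mulVec, dotProduct, transpose_apply, rigidityMatrix, Sym2.lift_mk, edgeVector,
    Fintype.sum_prod_type_right]
  refine Finset.sum_congr rfl fun c _ => ?_
  have : ∀ w : V, (Pi.single u 1 - Pi.single v 1 : V → ℝ) w * frameworkDirection p u v c * x (w, c)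
      = frameworkDirection p u v c *
        ((if w = u then x (w, c) else 0) - (if w = v then x (w, c) else 0)) := by
    intro w
    simp only [Pi.sub_apply, Pi.single_apply]
    split_ifs <;> ring
  simp only [this, ← Finset.mul_sum, Finset.sum_sub_distrib, Finset.sum_ite_eq',
    Finset.mem_univ, if_true]

theorem sum_edgeSet_eq_sum_lt {V : Type*} [Fintype V] [LinearOrder V] (G : SimpleGraph V)
    [DecidableRel G.Adj] (g : G.edgeSet → ℝ) (g' : V → V → ℝ)
    (hg : ∀ u v (h : s(u, v) ∈ G.edgeSet), g ⟨s(u, v), h⟩ = g' u v) :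
    ∑ e, g e = ∑ q : V × V with q.1 < q.2 ∧ G.Adj q.1 q.2, g' q.1 q.2 := by
  symm
  refine Finset.sum_bij (fun q hq => ⟨s(q.1, q.2), (Finset.mem_filter.1 hq).2.2⟩)
    (fun _ _ => Finset.mem_univ _) ?_ ?_ ?_
  · rintro ⟨u, v⟩ h1 ⟨u', v'⟩ h2 h
    simp only [Finset.mem_filter, Finset.mem_univ, true_and] at h1 h2
    have h := congrArg Subtype.val h
    simp only [Sym2.eq_iff] at h
    rcases h with ⟨rfl, rfl⟩ | ⟨rfl, rfl⟩
    · rfl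
    · exact absurd (h1.1.trans h2.1) (lt_irrefl _)
  · rintro ⟨e, he⟩ -
    induction e using Sym2.ind with
    | _ u v =>
      have hadj : G.Adj u v := he
      rcases lt_trichotomy u v with h | h | h
      · exact ⟨(u, v), by simp [h, hadj], rfl⟩
      · exact absurd h hadj.ne
      · exact ⟨(v, u), by simp [h, hadj.symm], Subtype.ext Sym2.eq_swap⟩
  · rintro ⟨u, v⟩ h
    exact (hg _ _ _).symm

theorem dotProduct_stiffnessMatrix_mulVec {V : Type*} [Fintype V] [LinearOrder V]
    (G : SimpleGraph V) [DecidableRel G.Adj] {d : ℕ} (p : V → EuclideanSpace ℝ (Fin d))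
    (x : V × Fin d → ℝ) :
    x ⬝ᵥ stiffnessMatrix G p *ᵥ x = ∑ q : V × V with q.1 < q.2 ∧ G.Adj q.1 q.2,
      (∑ c, frameworkDirection p q.1 q.2 c * (x (q.1, c) - x (q.2, c))) ^ 2 := by
  rw [stiffnessMatrix, ← mulVec_mulVec, dotProduct_mulVec, ← mulVec_transpose, dotProduct]
  refine sum_edgeSet_eq_sum_lt G _
    (fun u v => (∑ c, frameworkDirection p u v c * (x (u, c) - x (v, c))) ^ 2) fun u v h => ?_
  rw [rigidityMatrix_transpose_mulVec, sq]

/-! ### Poincaré inequalities on paths -/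

/-- Discrete Picone identity: the defect is `s t (b/t - a/s)²`. The convention `x / 0 = 0` makes the
degenerate cases hold. -/
theorem sq_sub_ge_groundState {a b s t : ℝ} (hs : 0 ≤ s) (ht : 0 ≤ t) (ha : s = 0 → a = 0)
    (hb : t = 0 → b = 0) :
    b ^ 2 * (1 - s / t) + a ^ 2 * (1 - t / s) ≤ (b - a) ^ 2 := by
  rcases hs.eq_or_lt with rfl | hs
  · simp [ha rfl]
  rcases ht.eq_or_lt with rfl | ht
  · simp [hb rfl]
  have : (b - a) ^ 2 - (b ^ 2 * (1 - s / t) + a ^ 2 * (1 - t / s))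
      = s * t * (b / t - a / s) ^ 2 := by
    field_simp
    ring
  nlinarith [mul_nonneg (mul_nonneg hs.le ht.le) (sq_nonneg (b / t - a / s))]

/-- Apply the Picone bound on each edge with the Dirichlet ground state `φ i = sin (π i / m)`. Since
`φ (i-1) + φ (i+1) = 2 cos (π/m) φ i`, the weights at an interior vertex add up to the eigenvalue.
-/
theorem dirichlet_path_inequality (m : ℕ) (Y : ℕ → ℝ) (h0 : Y 0 = 0) (hm : Y m = 0) :
    2 * (1 - Real.cos (Real.pi / m)) * ∑ i ∈ Finset.range m, Y i ^ 2 ≤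
      ∑ i ∈ Finset.range m, (Y (i + 1) - Y i) ^ 2 := by
  rcases Nat.eq_zero_or_pos m with rfl | hmpos
  · simp
  have hmR : (0 : ℝ) < m := by exact_mod_cast hmpos
  let θ := Real.pi / m
  let φ : ℕ → ℝ := fun i => Real.sin (θ * i)
  have hφm : θ * m = Real.pi := by simp only [θ]; field_simp
  have hφ0 : ∀ i ≤ m, 0 ≤ φ i := fun i hi => by
    refine Real.sin_nonneg_of_nonneg_of_le_pi (by positivity) ?_
    rw [← hφm]
    gcongr
  have hφpos : ∀ i, 0 < i → i < m → 0 < φ i := fun i hi him => by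
    have : (0 : ℝ) < i := by exact_mod_cast hi
    refine Real.sin_pos_of_pos_of_lt_pi (by positivity) ?_
    rw [← hφm]
    have : (i : ℝ) < m := by exact_mod_cast him
    gcongr
  have hY : ∀ i ≤ m, φ i = 0 → Y i = 0 := fun i hi h => by
    rcases Nat.eq_zero_or_pos i with rfl | hi0
    · exact h0
    rcases hi.eq_or_lt with rfl | him
    · exact hm
    exact absurd h (hφpos i hi0 him).ne'
  -- The numerator is `φ (i - 1)`, written so as to avoid truncated subtraction at `i = 0`.
  let F : ℕ → ℝ := fun i => Y i ^ 2 * (1 - Real.sin (θ * i - θ) / φ i)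
  have hF : ∑ i ∈ Finset.range m, F (i + 1) = ∑ i ∈ Finset.range m, F i := by
    have h1 := Finset.sum_range_succ F m
    have h2 := Finset.sum_range_succ' F m
    have h3 : F 0 = 0 := by simp [F, h0]
    have h4 : F m = 0 := by simp [F, hm]
    linarith
  calc _ = ∑ i ∈ Finset.range m, (F i + Y i ^ 2 * (1 - φ (i + 1) / φ i)) := by
        rw [Finset.mul_sum]
        refine Finset.sum_congr rfl fun i hi => ?_
        rcases Nat.eq_zero_or_pos i with rfl | hi0
        · simp [F, h0]
        have hp := hφpos i hi0 (Finset.mem_range.1 hi)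
        have e1 : φ (i + 1) = Real.sin (θ * i) * Real.cos θ + Real.cos (θ * i) * Real.sin θ := by
          simp only [φ]; push_cast; rw [mul_add, mul_one, Real.sin_add]
        have e2 : φ i = Real.sin (θ * i) := rfl
        simp only [F]
        rw [e1, Real.sin_sub, ← e2]
        field_simp
        ring
    _ = ∑ i ∈ Finset.range m, (F (i + 1) + Y i ^ 2 * (1 - φ (i + 1) / φ i)) := by
        rw [Finset.sum_add_distrib, Finset.sum_add_distrib, hF]
    _ ≤ _ := by
        refine Finset.sum_le_sum fun i hi => ?_
        have hi := Finset.mem_range.1 hi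
        have h := sq_sub_ge_groundState (hφ0 i hi.le) (hφ0 (i + 1) hi) (hY i hi.le) (hY _ hi)
        have e : θ * ((i + 1 : ℕ) : ℝ) - θ = θ * i := by push_cast; ring
        simp only [F, e]
        exact h

/-- Duality with the Dirichlet problem: the partial sums `Y` of `y` vanish at both ends. Summation
by parts and Cauchy–Schwarz give `(∑ y²)² ≤ (∑ Y²)(∑ (Δy)²)`, and the Dirichlet inequality bounds `∑
Y²` by `∑ y²`. -/
theorem path_poincare (m : ℕ) (y : ℕ → ℝ) (hy : ∑ i ∈ Finset.range m, y i = 0) :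
    2 * (1 - Real.cos (Real.pi / m)) * ∑ i ∈ Finset.range m, y i ^ 2 ≤
      ∑ i ∈ Finset.range (m - 1), (y (i + 1) - y i) ^ 2 := by
  rcases m with _ | m
  · simp
  let Y : ℕ → ℝ := fun k => ∑ i ∈ Finset.range k, y i
  have hYs : ∀ i, Y (i + 1) - Y i = y i := fun i => by simp [Y, Finset.sum_range_succ]
  have hD := dirichlet_path_inequality (m + 1) Y (by simp [Y]) hy
  simp only [hYs] at hD
  set lam := 2 * (1 - Real.cos (Real.pi / ((m + 1 : ℕ) : ℝ)))
  set S := ∑ i ∈ Finset.range (m + 1), y i ^ 2 with hS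
  set T := ∑ i ∈ Finset.range (m + 1), Y i ^ 2
  simp only [Nat.add_sub_cancel]
  set D := ∑ i ∈ Finset.range m, (y (i + 1) - y i) ^ 2
  have hlam : 0 ≤ lam := by
    have := Real.cos_le_one (Real.pi / ((m + 1 : ℕ) : ℝ))
    simp only [lam]; linarith
  have habel : S = -∑ i ∈ Finset.range m, Y (i + 1) * (y (i + 1) - y i) := by
    have key : ∀ k, ∑ i ∈ Finset.range (k + 1), y i ^ 2 =
        Y (k + 1) * y k - ∑ i ∈ Finset.range k, Y (i + 1) * (y (i + 1) - y i) := by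
      intro k
      induction k with
      | zero => simp [Y]; ring
      | succ k ih =>
        rw [Finset.sum_range_succ, ih, Finset.sum_range_succ]
        have := hYs (k + 1)
        have e : Y (k + 1 + 1) = Y (k + 1) + y (k + 1) := by linarith
        rw [e]
        ring
    rw [hS, key m]
    have : Y (m + 1) = 0 := hy
    rw [this]; ring
  have hCS : S ^ 2 ≤ T * D := by
    rw [habel, neg_sq]
    refine (Finset.sum_mul_sq_le_sq_mul_sq _ _ _).trans ?_
    have : ∑ i ∈ Finset.range m, Y (i + 1) ^ 2 = T := by
      simp only [T]
      rw [Finset.sum_range_succ']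
      simp [Y]
    rw [this]
  have hS0 : 0 ≤ S := Finset.sum_nonneg fun _ _ => sq_nonneg _
  have hD0 : 0 ≤ D := Finset.sum_nonneg fun _ _ => sq_nonneg _
  rcases hS0.eq_or_lt with h | h
  · rw [← h]; simpa using hD0
  · have h1 : lam * S * S ≤ D * S := by
      nlinarith [mul_le_mul_of_nonneg_left hCS hlam, mul_le_mul_of_nonneg_right hD hD0]
    exact le_of_mul_le_mul_right h1 h

/-- The Poincaré inequality along the consecutive elements of a finite subset of a linear order. -/
theorem consecutive_poincare {V : Type*} [LinearOrder V] (S : Finset V)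
    (E : Finset (V × V)) (hE : ∀ u ∈ S, ∀ v ∈ S, u < v → (∀ w ∈ S, ¬ (u < w ∧ w < v)) → (u, v) ∈ E)
    (z : V → ℝ) (hz : ∑ u ∈ S, z u = 0) :
    2 * (1 - Real.cos (Real.pi / S.card)) * ∑ u ∈ S, z u ^ 2 ≤
      ∑ q ∈ E, (z q.1 - z q.2) ^ 2 := by
  rcases S.eq_empty_or_nonempty with rfl | hne
  · simpa using Finset.sum_nonneg fun q _ => sq_nonneg (z q.1 - z q.2)
  set m := S.card with hm
  have hmpos : 0 < m := hne.card_pos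
  let o := S.orderEmbOfFin hm.symm
  let s : ℕ → V := fun k => if h : k < m then o ⟨k, h⟩ else o ⟨0, hmpos⟩
  have hs : ∀ k (h : k < m), s k = o ⟨k, h⟩ := fun k h => dif_pos h
  have hsum : ∀ g : V → ℝ, ∑ k ∈ Finset.range m, g (s k) = ∑ u ∈ S, g u := by
    intro g
    rw [Finset.sum_range]
    have : S = Finset.univ.map o.toEmbedding := by
      ext v
      simp only [Finset.mem_map, Finset.mem_univ, true_and, RelEmbedding.coe_toEmbedding]
      rw [← Set.mem_range, Finset.range_orderEmbOfFin, Finset.mem_coe]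
    conv_rhs => rw [this]
    rw [Finset.sum_map]
    exact Finset.sum_congr rfl fun k _ => by rw [hs k k.2]; rfl
  have hp := path_poincare m (fun k => z (s k)) (by rw [hsum]; exact hz)
  rw [hsum (fun u => z u ^ 2)] at hp
  refine hp.trans ?_
  have hinj : Set.InjOn (fun k => (s k, s (k + 1))) (Finset.range (m - 1) : Set ℕ) := by
    intro k hk l hl h
    simp only [Finset.coe_range, Set.mem_Iio] at hk hl
    have h1 := congrArg Prod.fst h
    simp only [hs k (by omega), hs l (by omega)] at h1
    simpa using o.injective h1
  calc _ = ∑ q ∈ (Finset.range (m - 1)).image (fun k => (s k, s (k + 1))),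
        (z q.1 - z q.2) ^ 2 := by
        rw [Finset.sum_image hinj]
        exact Finset.sum_congr rfl fun k _ => by ring
    _ ≤ _ := by
        refine Finset.sum_le_sum_of_subset_of_nonneg ?_ fun _ _ _ => sq_nonneg _
        intro q hq
        obtain ⟨k, hk, rfl⟩ := Finset.mem_image.1 hq
        have hk := Finset.mem_range.1 hk
        rw [hs k (by omega), hs (k + 1) (by omega)]
        refine hE _ (S.orderEmbOfFin_mem _ _) _ (S.orderEmbOfFin_mem _ _)
          (o.strictMono (by simp [Fin.lt_def])) ?_
        rintro w hw ⟨h1, h2⟩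
        have : w ∈ Set.range o := by rw [Finset.range_orderEmbOfFin]; exact hw
        obtain ⟨l, rfl⟩ := this
        have h1 := o.lt_iff_lt.1 h1
        have h2 := o.lt_iff_lt.1 h2
        simp only [Fin.lt_def] at h1 h2
        omega

/-! ### Trivial infinitesimal motions and the upper bound -/

/-- The antisymmetric sign of a pair of indices. -/
def skewSign {d : ℕ} (i j : Fin d) : ℝ := if i < j then 1 else if j < i then -1 else 0

theorem skewSign_swap {d : ℕ} (i j : Fin d) : skewSign j i = -skewSign i j := by
  rcases lt_trichotomy i j with h | h | h
  · simp [skewSign, h, h.not_gt]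
  · simp [skewSign, h]
  · simp [skewSign, h, h.not_gt]

theorem skewSign_ne_zero {d : ℕ} {i j : Fin d} (h : i ≠ j) : skewSign i j ≠ 0 := by
  rcases lt_or_gt_of_ne h with h | h
  · simp [skewSign, h]
  · simp [skewSign, h, h.not_gt]

theorem sum_skewSign_eq_zero {d : ℕ} (c : Sym2 (Fin d) → ℝ) (y : Fin d → ℝ) :
    ∑ i, y i * ∑ j, skewSign i j * c s(i, j) * y j = 0 := by
  have h : ∑ i, y i * ∑ j, skewSign i j * c s(i, j) * y j =
      -∑ i, y i * ∑ j, skewSign i j * c s(i, j) * y j := by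
    simp only [Finset.mul_sum]
    conv_lhs => rw [Finset.sum_comm]
    simp only [← Finset.sum_neg_distrib]
    refine Finset.sum_congr rfl fun i _ => Finset.sum_congr rfl fun j _ => ?_
    rw [skewSign_swap i j, Sym2.eq_swap]
    ring
  linarith

/-- The trivial infinitesimal motion `u ↦ b + A (p u)` of a framework, with the translation `b` and
the skew-symmetric matrix `A` read off from the diagonal and off-diagonal part of `c`. -/
def trivialMotion {V : Type*} {d : ℕ} (p : V → EuclideanSpace ℝ (Fin d)) :
    (Sym2 (Fin d) → ℝ) →ₗ[ℝ] (V × Fin d → ℝ) where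
  toFun c x := c s(x.2, x.2) + ∑ j, skewSign x.2 j * c s(x.2, j) * p x.1 j
  map_add' c c' := by
    ext x
    simp only [Pi.add_apply, mul_add, add_mul, Finset.sum_add_distrib]
    ring
  map_smul' r c := by
    ext x
    simp only [Pi.smul_apply, smul_eq_mul, RingHom.id_apply, mul_add, Finset.mul_sum]
    congr 1
    exact Finset.sum_congr rfl fun j _ => by ring

theorem trivialMotion_apply {V : Type*} {d : ℕ} (p : V → EuclideanSpace ℝ (Fin d))
    (c : Sym2 (Fin d) → ℝ) (u : V) (i : Fin d) :
    trivialMotion p c (u, i) = c s(i, i) + ∑ j, skewSign i j * c s(i, j) * p u j := rfl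

theorem trivialMotion_sub {V : Type*} {d : ℕ} (p : V → EuclideanSpace ℝ (Fin d))
    (c : Sym2 (Fin d) → ℝ) (u v : V) (i : Fin d) :
    trivialMotion p c (u, i) - trivialMotion p c (v, i) =
      ∑ j, skewSign i j * c s(i, j) * (p u - p v) j := by
  simp only [trivialMotion_apply, PiLp.sub_apply, mul_sub, Finset.sum_sub_distrib]
  ring

theorem trivialMotion_direction {V : Type*} {d : ℕ} (p : V → EuclideanSpace ℝ (Fin d))
    (c : Sym2 (Fin d) → ℝ) (u v : V) :
    ∑ i, frameworkDirection p u v i * (trivialMotion p c (u, i) - trivialMotion p c (v, i)) = 0 := by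
  obtain ⟨t, ht⟩ : ∃ t : ℝ, frameworkDirection p u v = t • (p u - p v) := by
    unfold frameworkDirection
    split_ifs
    · exact ⟨_, rfl⟩
    · exact ⟨0, by simp⟩
  have h := sum_skewSign_eq_zero c (fun i => (p u - p v) i)
  simp only [trivialMotion_sub, ht, PiLp.smul_apply, smul_eq_mul, mul_assoc, ← Finset.mul_sum]
  simp only [mul_assoc] at h
  rw [h, mul_zero]

/-- If the motion vanishes, every row of the skew matrix is orthogonal to all differences `p u - p
v`, which span the space; so the matrix is zero, and then so is the translation. -/
theorem trivialMotion_injective {V : Type*} [Nonempty V] {d : ℕ}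
    {p : V → EuclideanSpace ℝ (Fin d)} (hp : affineSpan ℝ (Set.range p) = ⊤) :
    Function.Injective (trivialMotion p) := by
  rw [← LinearMap.ker_eq_bot, LinearMap.ker_eq_bot']
  intro c hc
  have hc' : ∀ u i, trivialMotion p c (u, i) = 0 := fun u i => congrFun hc (u, i)
  have hspan : vectorSpan ℝ (Set.range p) = ⊤ := by
    rw [← direction_affineSpan, hp, AffineSubspace.direction_top]
  have hoff : ∀ i j, skewSign i j * c s(i, j) = 0 := by
    intro i
    let a : EuclideanSpace ℝ (Fin d) := WithLp.toLp 2 fun j => skewSign i j * c s(i, j)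
    have ha : vectorSpan ℝ (Set.range p) ≤ (ℝ ∙ a)ᗮ := by
      rw [vectorSpan, Submodule.span_le]
      rintro _ ⟨_, ⟨u, rfl⟩, _, ⟨v, rfl⟩, rfl⟩
      rw [SetLike.mem_coe, Submodule.mem_orthogonal_singleton_iff_inner_right]
      have h := trivialMotion_sub p c u v i
      rw [hc', hc', sub_zero] at h
      simp only [PiLp.inner_apply, a, vsub_eq_sub]
      rw [h]
      exact Finset.sum_congr rfl fun j _ => by simp [mul_comm]
    rw [hspan, top_le_iff, Submodule.orthogonal_eq_top_iff, Submodule.span_singleton_eq_bot] at ha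
    intro j
    exact congrArg (fun z : EuclideanSpace ℝ (Fin d) => z j) ha
  ext e
  induction e using Sym2.ind with
  | _ i j =>
    by_cases hij : i = j
    · subst hij
      have h := hc' (Classical.arbitrary V) i
      rw [trivialMotion_apply, Finset.sum_eq_zero (fun j _ => by rw [hoff, zero_mul])] at h
      simpa using h
    · exact (mul_eq_zero.1 (hoff i j)).resolve_left (skewSign_ne_zero hij)

theorem smallestEigenvalue_stiffnessMatrix_le {V : Type*} [Fintype V] [LinearOrder V]
    (G : SimpleGraph V) [DecidableRel G.Adj] {d : ℕ} (hd : 0 < d)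
    {p : V → EuclideanSpace ℝ (Fin d)} (hp : affineSpan ℝ (Set.range p) = ⊤)
    {f : V → ℝ} (hf : ∑ u, f u = 0) (hf0 : f ≠ 0) {a : ℝ}
    (hfa : ∑ q : V × V with q.1 < q.2 ∧ G.Adj q.1 q.2, (f q.1 - f q.2) ^ 2 ≤ a * ∑ u, f u ^ 2) :
    smallestEigenvalue (stiffnessMatrix_isHermitian G p) ((d + 1).choose 2 + 1) ≤ a := by
  obtain ⟨u₀, hu₀⟩ := Function.ne_iff.1 hf0
  have : Nonempty V := ⟨u₀⟩
  let m : Fin d → ℝ := fun j => ∑ u, f u * p u j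
  obtain ⟨w, hw0, hw⟩ : ∃ w : Fin d → ℝ, w ≠ 0 ∧
      ∀ c : Sym2 (Fin d) → ℝ, ∑ i, w i * ∑ j, skewSign i j * c s(i, j) * m j = 0 := by
    by_cases hm : m = 0
    · refine ⟨Pi.single ⟨0, hd⟩ 1, by simp, fun c => by simp [hm]⟩
    · exact ⟨m, hm, fun c => sum_skewSign_eq_zero c m⟩
  let t : V × Fin d → ℝ := fun x => f x.1 * w x.2
  have htt : t ⬝ᵥ t = (∑ u, f u ^ 2) * ∑ i, w i ^ 2 := by
    simp only [dotProduct, Fintype.sum_prod_type, Finset.sum_mul_sum, t]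
    exact Finset.sum_congr rfl fun u _ => Finset.sum_congr rfl fun i _ => by ring
  have hf2 : 0 < ∑ u, f u ^ 2 :=
    Finset.sum_pos' (fun _ _ => sq_nonneg _) ⟨u₀, Finset.mem_univ _, by simpa using pow_pos (abs_pos.2 hu₀) 2⟩
  have hw2 : 0 < ∑ i, w i ^ 2 := by
    obtain ⟨i₀, hi₀⟩ := Function.ne_iff.1 hw0
    exact Finset.sum_pos' (fun _ _ => sq_nonneg _) ⟨i₀, Finset.mem_univ _, by simpa using pow_pos (abs_pos.2 hi₀) 2⟩
  have htt0 : 0 < t ⬝ᵥ t := htt ▸ mul_pos hf2 hw2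
  -- The sign of `a` allows `a * s² (t ⬝ᵥ t)` to be replaced by the larger `a * (T (c, s) ⬝ᵥ T (c,
  -- s))` at the end.
  have ha0 : 0 ≤ a := by
    by_contra h
    have := Finset.sum_nonneg (s := {q : V × V | q.1 < q.2 ∧ G.Adj q.1 q.2})
      fun q _ => sq_nonneg (f q.1 - f q.2)
    nlinarith
  have horth : ∀ c, trivialMotion p c ⬝ᵥ t = 0 := by
    intro c
    simp only [dotProduct, Fintype.sum_prod_type_right, trivialMotion_apply, t]
    rw [← hw c]
    refine Finset.sum_congr rfl fun i _ => ?_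
    have e : ∀ u, (c s(i, i) + ∑ j, skewSign i j * c s(i, j) * p u j) * (f u * w i) =
        c s(i, i) * w i * f u + ∑ j, w i * (skewSign i j * c s(i, j) * (f u * p u j)) := by
      intro u
      rw [add_mul, Finset.sum_mul]
      congr 1
      · ring
      · exact Finset.sum_congr rfl fun j _ => by ring
    simp only [e, Finset.sum_add_distrib, ← Finset.mul_sum, hf, mul_zero, zero_add]
    rw [Finset.sum_comm]
    simp only [← Finset.mul_sum, m]
  let T : ((Sym2 (Fin d) → ℝ) × ℝ) →ₗ[ℝ] (V × Fin d → ℝ) :=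
    (trivialMotion p).coprod (LinearMap.toSpanSingleton ℝ _ t)
  have hT : ∀ c s, T (c, s) = trivialMotion p c + s • t := fun c s => by simp [T]
  have hnorm : ∀ c s, s ^ 2 * (t ⬝ᵥ t) ≤ T (c, s) ⬝ᵥ T (c, s) := by
    intro c s
    rw [hT, add_dotProduct, dotProduct_add, dotProduct_add, smul_dotProduct, dotProduct_smul,
      smul_dotProduct, dotProduct_smul, dotProduct_comm t (trivialMotion p c), horth]
    have : 0 ≤ trivialMotion p c ⬝ᵥ trivialMotion p c :=
      Finset.sum_nonneg fun _ _ => mul_self_nonneg _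
    simp only [smul_eq_mul]
    nlinarith
  refine smallestEigenvalue_le_of_injective _ (M := (Sym2 (Fin d) → ℝ) × ℝ)
    (by simp [Sym2.card]) T ?_ ?_
  · rw [← LinearMap.ker_eq_bot, LinearMap.ker_eq_bot']
    rintro ⟨c, s⟩ h
    have h1 := hnorm c s
    rw [h, zero_dotProduct] at h1
    have hs : s = 0 := by
      by_contra hs
      have := mul_pos (sq_pos_of_ne_zero hs) htt0
      linarith
    subst hs
    rw [hT, zero_smul, add_zero] at h
    rw [(map_eq_zero_iff _ (trivialMotion_injective hp)).1 h]
    rfl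
  · rintro ⟨c, s⟩
    refine le_trans ?_ (mul_le_mul_of_nonneg_left (hnorm c s) ha0)
    rw [dotProduct_stiffnessMatrix_mulVec, htt]
    calc _ ≤ ∑ q : V × V with q.1 < q.2 ∧ G.Adj q.1 q.2,
          s ^ 2 * (∑ i, w i ^ 2) * (f q.1 - f q.2) ^ 2 := by
          refine Finset.sum_le_sum fun q _ => ?_
          have e : ∑ i, frameworkDirection p q.1 q.2 i * (T (c, s) (q.1, i) - T (c, s) (q.2, i)) =
              s * (f q.1 - f q.2) * ∑ i, frameworkDirection p q.1 q.2 i * w i := by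
            have h0 := trivialMotion_direction p c q.1 q.2
            rw [Finset.mul_sum, ← sub_zero (∑ i, _ * _), ← h0, ← Finset.sum_sub_distrib]
            refine Finset.sum_congr rfl fun i _ => ?_
            simp only [hT, Pi.add_apply, Pi.smul_apply, smul_eq_mul, t]
            ring
          have hdir : ∑ i, frameworkDirection p q.1 q.2 i ^ 2 ≤ 1 := by
            rw [← EuclideanSpace.real_norm_sq_eq]
            unfold frameworkDirection
            split_ifs with hne
            · rw [norm_smul, norm_inv, norm_norm, inv_mul_cancel₀ (by simpa [sub_eq_zero] using hne)]
              norm_num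
            · simp
          rw [e, mul_pow]
          have hCS := Finset.sum_mul_sq_le_sq_mul_sq Finset.univ
            (fun i => frameworkDirection p q.1 q.2 i) w
          have h2 : (∑ i, frameworkDirection p q.1 q.2 i * w i) ^ 2 ≤ ∑ i, w i ^ 2 :=
            hCS.trans (mul_le_of_le_one_left hw2.le hdir)
          calc _ ≤ (s * (f q.1 - f q.2)) ^ 2 * ∑ i, w i ^ 2 :=
                mul_le_mul_of_nonneg_left h2 (sq_nonneg _)
            _ = _ := by ring
      _ ≤ _ := by
          rw [← Finset.mul_sum]
          calc _ ≤ s ^ 2 * (∑ i, w i ^ 2) * (a * ∑ u, f u ^ 2) :=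
                mul_le_mul_of_nonneg_left hfa (by positivity)
            _ = _ := by ring

theorem sum_cos_two_pi_div {n : ℕ} (hn : 2 ≤ n) :
    ∑ u : Fin n, Real.cos (2 * Real.pi * u / n) = 0 ∧
      ∑ u : Fin n, Real.sin (2 * Real.pi * u / n) = 0 := by
  have hp := Complex.isPrimitiveRoot_exp n (by omega)
  have h := hp.geom_sum_eq_zero (by omega)
  have e : ∀ u : ℕ, Complex.exp (2 * Real.pi * Complex.I / n) ^ u =
      Complex.exp ((2 * Real.pi * u / n : ℝ) * Complex.I) := by
    intro u
    rw [← Complex.exp_nat_mul]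
    congr 1
    push_cast
    ring
  simp only [e] at h
  rw [Finset.sum_range] at h
  constructor
  · have h2 := congrArg Complex.re h
    simpa only [Complex.re_sum, Complex.exp_ofReal_mul_I_re, Complex.zero_re] using h2
  · have h2 := congrArg Complex.im h
    simpa only [Complex.im_sum, Complex.exp_ofReal_mul_I_im, Complex.zero_im] using h2

/-- An edge is determined by its lower endpoint and its gap, so each gap `k ≤ d` occurs at most `n`
times. -/
theorem sum_generalizedPath_edges_le (n d : ℕ) (g : ℕ → ℝ) (hg : ∀ k, 0 ≤ g k) :
    ∑ q : Fin n × Fin n with q.1 < q.2 ∧ (generalizedPath n d).Adj q.1 q.2, g (q.2 - q.1) ≤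
      n * ∑ k ∈ Finset.Icc 1 d, g k := by
  have hR : (n : ℝ) * ∑ k ∈ Finset.Icc 1 d, g k =
      ∑ x ∈ (Finset.univ : Finset (Fin n)) ×ˢ Finset.Icc 1 d, g x.2 := by
    rw [Finset.sum_product]; simp
  rw [hR]
  have hinj : Set.InjOn (fun q : Fin n × Fin n => (q.1, (q.2 : ℕ) - q.1))
      {q : Fin n × Fin n | q.1 < q.2 ∧ (generalizedPath n d).Adj q.1 q.2} := by
    rintro ⟨u, v⟩ ⟨h1, -⟩ ⟨u', v'⟩ ⟨h2, -⟩ h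
    simp only [Prod.mk.injEq] at h h1 h2 ⊢
    obtain ⟨rfl, h⟩ := h
    refine ⟨rfl, ?_⟩
    simp only [Fin.lt_def] at h1 h2
    ext; omega
  have hinj' : Set.InjOn (fun q : Fin n × Fin n => (q.1, (q.2 : ℕ) - q.1))
      ((Finset.univ.filter fun q : Fin n × Fin n =>
        q.1 < q.2 ∧ (generalizedPath n d).Adj q.1 q.2 : Finset _) : Set (Fin n × Fin n)) := by
    simpa using hinj
  rw [← Finset.sum_image (f := fun x : Fin n × ℕ => g x.2) hinj']
  refine Finset.sum_le_sum_of_subset_of_nonneg ?_ fun _ _ _ => hg _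
  intro x hx
  obtain ⟨⟨u, v⟩, hq, rfl⟩ := Finset.mem_image.1 hx
  obtain ⟨h1, h2⟩ := (Finset.mem_filter.1 hq).2
  simp only [generalizedPath, Fin.lt_def] at h1 h2
  simp only [Finset.mem_product, Finset.mem_univ, Finset.mem_Icc, true_and]
  omega

/-- Cosine and sine together trace the regular `n`-gon, whose squared chord lengths depend only on
the gap. The inequality holds for the two functions added, hence for at least one of them. -/
theorem exists_test_function {n d : ℕ} (hn : 3 ≤ n) :
    ∃ f : Fin n → ℝ, ∑ u, f u = 0 ∧ f ≠ 0 ∧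
      ∑ q : Fin n × Fin n with q.1 < q.2 ∧ (generalizedPath n d).Adj q.1 q.2,
        (f q.1 - f q.2) ^ 2 ≤
      (2 * (d : ℝ) - 2 * ∑ k ∈ Finset.Icc 1 d, Real.cos (2 * (k : ℝ) * Real.pi / (n : ℝ))) *
        ∑ u, f u ^ 2 := by
  have hnR : (3 : ℝ) ≤ n := by exact_mod_cast hn
  set a := 2 * (d : ℝ) - 2 * ∑ k ∈ Finset.Icc 1 d, Real.cos (2 * (k : ℝ) * Real.pi / (n : ℝ))
    with ha
  obtain ⟨hc, hs⟩ := sum_cos_two_pi_div (n := n) (by omega)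
  set fc : Fin n → ℝ := fun u => Real.cos (2 * Real.pi * u / n)
  set fs : Fin n → ℝ := fun u => Real.sin (2 * Real.pi * u / n)
  let g : ℕ → ℝ := fun k => 2 * (1 - Real.cos (2 * k * Real.pi / n))
  have hedge : ∀ q ∈ (Finset.univ.filter fun q : Fin n × Fin n =>
      q.1 < q.2 ∧ (generalizedPath n d).Adj q.1 q.2),
      (fc q.1 - fc q.2) ^ 2 + (fs q.1 - fs q.2) ^ 2 = g (q.2 - q.1) := by
    rintro ⟨u, v⟩ hq
    have h := (Finset.mem_filter.1 hq).2.1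
    simp only [fc, fs, g]
    rw [Nat.cast_sub (Fin.le_def.1 h.le)]
    have e : 2 * ((v : ℝ) - u) * Real.pi / n = 2 * Real.pi * v / n - 2 * Real.pi * u / n := by ring
    rw [e, Real.cos_sub]
    nlinarith [Real.sin_sq_add_cos_sq (2 * Real.pi * v / n),
      Real.sin_sq_add_cos_sq (2 * Real.pi * u / n)]
  have hsq : ∑ u, fc u ^ 2 + ∑ u, fs u ^ 2 = n := by
    rw [← Finset.sum_add_distrib]
    simp [fc, fs]
  have hga : ∑ k ∈ Finset.Icc 1 d, g k = a := by
    simp only [g, ← Finset.mul_sum, Finset.sum_sub_distrib, ha]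
    simp
    ring
  have htot : ∑ q : Fin n × Fin n with q.1 < q.2 ∧ (generalizedPath n d).Adj q.1 q.2,
        (fc q.1 - fc q.2) ^ 2 +
      ∑ q : Fin n × Fin n with q.1 < q.2 ∧ (generalizedPath n d).Adj q.1 q.2,
        (fs q.1 - fs q.2) ^ 2 ≤ a * ∑ u, fc u ^ 2 + a * ∑ u, fs u ^ 2 := by
    rw [← Finset.sum_add_distrib, Finset.sum_congr rfl hedge, ← mul_add, hsq, ← hga, mul_comm _ (n : ℝ)]
    refine sum_generalizedPath_edges_le n d g fun k => ?_
    have := Real.cos_le_one (2 * k * Real.pi / n)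
    simp only [g]; linarith
  by_cases h : ∑ q : Fin n × Fin n with q.1 < q.2 ∧ (generalizedPath n d).Adj q.1 q.2,
        (fc q.1 - fc q.2) ^ 2 ≤ a * ∑ u, fc u ^ 2
  · refine ⟨fc, hc, fun h0 => ?_, h⟩
    have := congrFun h0 ⟨0, by omega⟩
    simp [fc] at this
  · refine ⟨fs, hs, fun h0 => ?_, by linarith⟩
    have := congrFun h0 ⟨1, by omega⟩
    simp only [fs, Pi.zero_apply, Nat.cast_one, mul_one] at this
    refine absurd this (Real.sin_pos_of_pos_of_lt_pi (by positivity) ?_).ne'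
    rw [div_lt_iff₀ (by positivity)]
    nlinarith [Real.pi_pos]

theorem smallestEigenvalue_generalizedPath_le {n d : ℕ} (hd : 0 < d) (hn : 3 ≤ n)
    {p : Fin n → EuclideanSpace ℝ (Fin d)} (hp : affineSpan ℝ (Set.range p) = ⊤) :
    smallestEigenvalue (stiffnessMatrix_isHermitian (generalizedPath n d) p)
        ((d + 1).choose 2 + 1) ≤
      2 * (d : ℝ) - 2 * ∑ k ∈ Finset.Icc 1 d, Real.cos (2 * (k : ℝ) * Real.pi / (n : ℝ)) := by
  obtain ⟨f, h1, h2, h3⟩ := exists_test_function (d := d) hn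
  exact smallestEigenvalue_stiffnessMatrix_le _ hd hp h1 h2 h3

/-! ### Residue classes in the generalized path -/

/-- The residue class modulo `d` of a vertex. -/
def residue (d : ℕ) [NeZero d] {n : ℕ} (u : Fin n) : Fin d := Fin.ofNat d u

theorem residue_eq_iff {d : ℕ} [NeZero d] {n : ℕ} {u : Fin n} {i : Fin d} :
    residue d u = i ↔ (u : ℕ) % d = i := by
  rw [Fin.ext_iff, residue, Fin.val_ofNat]

/-- The edges of the generalized path, oriented upwards. -/
def pathEdges (n d : ℕ) : Finset (Fin n × Fin n) :=
  Finset.univ.filter fun q => q.1 < q.2 ∧ (generalizedPath n d).Adj q.1 q.2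

theorem mem_pathEdges {n d : ℕ} {u v : Fin n} :
    (u, v) ∈ pathEdges n d ↔ u < v ∧ (v : ℕ) ≤ u + d := by
  simp only [pathEdges, generalizedPath, Finset.mem_filter, Finset.mem_univ, true_and, Fin.lt_def]
  omega

/-- The vertices of a given residue class. -/
def residueSet (n : ℕ) {d : ℕ} [NeZero d] (i : Fin d) : Finset (Fin n) :=
  Finset.univ.filter fun u => residue d u = i

theorem mem_residueSet {n d : ℕ} [NeZero d] {i : Fin d} {u : Fin n} :
    u ∈ residueSet n i ↔ residue d u = i := by
  simp [residueSet]

/-- Otherwise `u + d` would be an element of `S` strictly between `u` and `v`. -/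
theorem le_add_of_consecutive {n d : ℕ} [NeZero d] {S : Finset (Fin n)}
    (hS : ∀ u ∈ S, ∀ w : Fin n, residue d w = residue d u → w ∈ S) {u v : Fin n} (hu : u ∈ S)
    (hno : ∀ w ∈ S, ¬ (u < w ∧ w < v)) : (v : ℕ) ≤ u + d := by
  by_contra! h
  have hd := NeZero.pos d
  refine hno ⟨u + d, by omega⟩ (hS u hu _ ?_) ⟨?_, ?_⟩
  · rw [residue_eq_iff]
    simp [residue]
  · simp [Fin.lt_def]; omega
  · simpa [Fin.lt_def] using h

theorem exists_residue_between {n d : ℕ} [NeZero d] {u v : Fin n} (huv : u < v)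
    (h : residue d u = residue d v) {j : Fin d} (hj : j ≠ residue d u) :
    ∃ w : Fin n, residue d w = j ∧ u < w ∧ w < v := by
  have hd := NeZero.pos d
  have hv : (u : ℕ) + d ≤ v := by
    have h1 : (v : ℕ) % d = u % d := by
      have := residue_eq_iff.1 h
      simp only [residue, Fin.val_ofNat] at this
      exact this.symm
    have h2 : d ∣ v - u := (Nat.modEq_iff_dvd' (Fin.le_def.1 huv.le)).1 h1.symm
    have := Nat.le_of_dvd (by have := Fin.lt_def.1 huv; omega) h2
    omega
  -- The residue of `j - u` modulo `d`, so that `u + t` is the first vertex of class `j` from `u`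
  -- on.
  set t := ((j : ℕ) + (d - u % d)) % d with ht
  have htd : t < d := Nat.mod_lt _ hd
  have hw : ((u : ℕ) + t) % d = j := by
    have h1 : (u : ℕ) + (j + (d - u % d)) = j + d * (u / d + 1) := by
      have := Nat.div_add_mod (u : ℕ) d
      have := Nat.mod_lt (u : ℕ) hd
      rw [mul_add, mul_one]
      omega
    rw [ht, Nat.add_mod_mod, h1, Nat.add_mul_mod_self_left, Nat.mod_eq_of_lt j.2]
  have ht0 : t ≠ 0 := by
    intro h0
    rw [h0, add_zero] at hw
    exact hj (residue_eq_iff.2 hw).symm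
  refine ⟨⟨u + t, by omega⟩, residue_eq_iff.2 hw, ?_, ?_⟩
  · simp [Fin.lt_def]; omega
  · simp [Fin.lt_def]; omega

theorem card_residueSet_le (n : ℕ) {d : ℕ} [NeZero d] (i : Fin d) :
    (residueSet n i).card ≤ ⌈(n : ℝ) / (d : ℝ)⌉₊ := by
  have hd : 0 < d := NeZero.pos d
  rw [← Finset.card_range ⌈(n : ℝ) / (d : ℝ)⌉₊]
  refine Finset.card_le_card_of_injOn (fun u => (u : ℕ) / d) ?_ ?_
  · intro u _
    simp only [Finset.coe_range, Set.mem_Iio]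
    rw [Nat.lt_ceil]
    refine lt_of_le_of_lt Nat.cast_div_le ?_
    have : ((u : ℕ) : ℝ) < n := by exact_mod_cast u.2
    gcongr
  · intro u hu v hv h
    have h1 := residue_eq_iff.1 (mem_residueSet.1 hu)
    have h2 := residue_eq_iff.1 (mem_residueSet.1 hv)
    dsimp only at h
    ext
    rw [← Nat.div_add_mod (u : ℕ) d, ← Nat.div_add_mod (v : ℕ) d, h, h1, h2]

theorem consecutive_poincare_of_card_le {V : Type*} [LinearOrder V] {S : Finset V} {N : ℕ}
    (hN : S.card ≤ N) (E : Finset (V × V))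
    (hE : ∀ u ∈ S, ∀ v ∈ S, u < v → (∀ w ∈ S, ¬ (u < w ∧ w < v)) → (u, v) ∈ E)
    (z : V → ℝ) (hz : ∑ u ∈ S, z u = 0) :
    2 * (1 - Real.cos (Real.pi / N)) * ∑ u ∈ S, z u ^ 2 ≤ ∑ q ∈ E, (z q.1 - z q.2) ^ 2 := by
  rcases S.eq_empty_or_nonempty with rfl | hne
  · simpa using Finset.sum_nonneg fun q _ => sq_nonneg (z q.1 - z q.2)
  refine le_trans (mul_le_mul_of_nonneg_right ?_ (Finset.sum_nonneg fun _ _ => sq_nonneg _))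
    (consecutive_poincare S E hE z hz)
  have h1 : (1 : ℝ) ≤ S.card := by exact_mod_cast hne.card_pos
  have h2 : (S.card : ℝ) ≤ N := by exact_mod_cast hN
  have := Real.cos_le_cos_of_nonneg_of_le_pi (x := Real.pi / N) (y := Real.pi / S.card)
    (by positivity) (div_le_self Real.pi_pos.le h1) (by gcongr)
  linarith

/-! ### The limit quadratic form -/

/-- The quadratic form of a generalized framework with edge directions `D`. -/
def directionForm {n d : ℕ} (D : Fin n → Fin n → Fin d → ℝ) (x : Fin n × Fin d → ℝ) : ℝ :=
  ∑ q ∈ pathEdges n d, (∑ i, D q.1 q.2 i * (x (q.1, i) - x (q.2, i))) ^ 2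

theorem sum_same_residue_ge {n d N : ℕ} [NeZero d]
    (hN : ∀ i : Fin d, (residueSet n i).card ≤ N) (z : Fin n → ℝ)
    (hz : ∀ i : Fin d, ∑ u ∈ residueSet n i, z u = 0) :
    2 * (1 - Real.cos (Real.pi / N)) * ∑ u, z u ^ 2 ≤
      ∑ q ∈ pathEdges n d with residue d q.1 = residue d q.2, (z q.1 - z q.2) ^ 2 := by
  rw [← Finset.sum_fiberwise Finset.univ (fun u : Fin n => residue d u),
    ← Finset.sum_fiberwise (Finset.filter _ (pathEdges n d)) (fun q => residue d q.1),
    Finset.mul_sum]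
  refine Finset.sum_le_sum fun i _ => ?_
  refine consecutive_poincare_of_card_le (hN i) _ (fun u hu v hv huv hno => ?_) z (hz i)
  have hu' := mem_residueSet.1 hu
  have hv' := mem_residueSet.1 hv
  simp only [Finset.mem_filter, mem_pathEdges]
  refine ⟨⟨⟨huv, le_add_of_consecutive (d := d) (fun a ha w hw => ?_) hu hno⟩,
    hu'.trans hv'.symm⟩, hu'⟩
  rw [mem_residueSet, hw, mem_residueSet.1 ha]

/-- Between two vertices of one class lies a vertex of the other, so consecutive elements of the
union always form an edge joining the two classes. -/
theorem sum_pair_residue_ge {n d N : ℕ} [NeZero d] {i j : Fin d} (hij : i ≠ j)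
    (hN : (residueSet n i ∪ residueSet n j).card ≤ N) (y : Fin n → ℝ)
    (hy : ∑ u ∈ residueSet n i ∪ residueSet n j, y u = 0) :
    2 * (1 - Real.cos (Real.pi / N)) *
        (∑ u ∈ residueSet n i, y u ^ 2 + ∑ u ∈ residueSet n j, y u ^ 2) ≤
      ∑ q ∈ pathEdges n d with residue d q.1 = i ∧ residue d q.2 = j, (y q.1 - y q.2) ^ 2 +
      ∑ q ∈ pathEdges n d with residue d q.1 = j ∧ residue d q.2 = i, (y q.1 - y q.2) ^ 2 := by
  have hdisj : Disjoint (residueSet n i) (residueSet n j) := by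
    rw [Finset.disjoint_left]
    intro u hu hv
    exact hij ((mem_residueSet.1 hu).symm.trans (mem_residueSet.1 hv))
  have hdisj' : Disjoint
      ((pathEdges n d).filter fun q => residue d q.1 = i ∧ residue d q.2 = j)
      ((pathEdges n d).filter fun q => residue d q.1 = j ∧ residue d q.2 = i) := by
    rw [Finset.disjoint_left]
    intro q hq hq'
    exact hij ((Finset.mem_filter.1 hq).2.1.symm.trans (Finset.mem_filter.1 hq').2.1)
  rw [← Finset.sum_union hdisj, ← Finset.sum_union hdisj']
  refine consecutive_poincare_of_card_le hN _ (fun u hu v hv huv hno => ?_) y hy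
  have hmem : (u, v) ∈ pathEdges n d := by
    refine mem_pathEdges.2 ⟨huv, le_add_of_consecutive (d := d) (fun a ha w hw => ?_) hu hno⟩
    simpa only [Finset.mem_union, mem_residueSet, hw] using ha
  have hne : residue d u ≠ residue d v := by
    intro h
    obtain ⟨k, hk, hkS⟩ : ∃ k, k ≠ residue d u ∧ (k = i ∨ k = j) := by
      by_cases hi : i = residue d u
      · exact ⟨j, fun hj => hij (hi.trans hj.symm), Or.inr rfl⟩
      · exact ⟨i, hi, Or.inl rfl⟩
    obtain ⟨w, hw, hb⟩ := exists_residue_between huv h hk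
    exact hno w (by simpa only [Finset.mem_union, mem_residueSet, hw] using hkS) hb
  simp only [Finset.mem_union, mem_residueSet] at hu hv
  simp only [Finset.mem_union, Finset.mem_filter, hmem, true_and]
  rcases hu with hu | hu <;> rcases hv with hv | hv
  · exact absurd (hu.trans hv.symm) hne
  · exact Or.inl ⟨hu, hv⟩
  · exact Or.inr ⟨hu, hv⟩
  · exact absurd (hu.trans hv.symm) hne

theorem sum_different_residue_ge {n d N : ℕ} [NeZero d]
    (hN : ∀ i j : Fin d, i ≠ j → (residueSet n i ∪ residueSet n j).card ≤ N)
    (x : Fin n × Fin d → ℝ)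
    (hx : ∀ i j : Fin d, i ≠ j → ∑ u ∈ residueSet n i ∪ residueSet n j, (x (u, i) - x (u, j)) = 0) :
    2 * (1 - Real.cos (Real.pi / N)) * ∑ u, ∑ j, (x (u, residue d u) - x (u, j)) ^ 2 ≤
      ∑ q ∈ pathEdges n d with residue d q.1 ≠ residue d q.2,
        ((x (q.1, residue d q.1) - x (q.1, residue d q.2)) -
          (x (q.2, residue d q.1) - x (q.2, residue d q.2))) ^ 2 := by
  set lam := 2 * (1 - Real.cos (Real.pi / N))
  let y : Fin d → Fin d → Fin n → ℝ := fun i j u => x (u, i) - x (u, j)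
  let B : Fin d → Fin d → ℝ := fun i j =>
    ∑ q ∈ pathEdges n d with residue d q.1 = i ∧ residue d q.2 = j, (y i j q.1 - y i j q.2) ^ 2
  let P : Fin d → Fin d → ℝ := fun i j => ∑ u ∈ residueSet n i, y i j u ^ 2
  have hB : ∀ i j, lam * (P i j + P j i) ≤ B i j + B j i := by
    intro i j
    have e1 : P j i = ∑ u ∈ residueSet n j, y i j u ^ 2 :=
      Finset.sum_congr rfl fun u _ => by simp only [y]; ring
    have e2 : B j i = ∑ q ∈ pathEdges n d with residue d q.1 = j ∧ residue d q.2 = i,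
        (y i j q.1 - y i j q.2) ^ 2 :=
      Finset.sum_congr rfl fun q _ => by simp only [y]; ring
    by_cases hij : i = j
    · subst hij
      have hP0 : P i i = 0 := by simp [P, y]
      have hB0 : B i i = 0 := by simp [B, y]
      rw [hP0, hB0]; simp
    · rw [e1, e2]
      exact sum_pair_residue_ge hij (hN i j hij) (y i j) (hx i j hij)
  have hP : ∑ u, ∑ j, (x (u, residue d u) - x (u, j)) ^ 2 = ∑ i, ∑ j, P i j := by
    rw [← Finset.sum_fiberwise Finset.univ (fun u : Fin n => residue d u)]
    refine Finset.sum_congr rfl fun i _ => ?_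
    simp only [P]
    rw [Finset.sum_comm]
    refine Finset.sum_congr rfl fun j _ => Finset.sum_congr rfl fun u hu => ?_
    rw [(Finset.mem_filter.1 hu).2]
  have hBs : ∑ q ∈ pathEdges n d with residue d q.1 ≠ residue d q.2,
        ((x (q.1, residue d q.1) - x (q.1, residue d q.2)) -
          (x (q.2, residue d q.1) - x (q.2, residue d q.2))) ^ 2 = ∑ i, ∑ j, B i j := by
    rw [Finset.sum_filter_of_ne]
    · rw [← Finset.sum_fiberwise (pathEdges n d) (fun q => (residue d q.1, residue d q.2)),
        Fintype.sum_prod_type]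
      refine Finset.sum_congr rfl fun i _ => Finset.sum_congr rfl fun j _ => ?_
      simp only [B, Prod.mk.injEq]
      refine Finset.sum_congr rfl fun q hq => ?_
      obtain ⟨h1, h2⟩ := (Finset.mem_filter.1 hq).2
      rw [h1, h2]
    · intro q _ h heq
      rw [heq] at h
      simp at h
  rw [hP, hBs]
  have hsum := Finset.sum_le_sum fun i (_ : i ∈ Finset.univ) =>
    Finset.sum_le_sum fun j (_ : j ∈ Finset.univ) => hB i j
  simp only [Finset.sum_add_distrib, ← Finset.mul_sum] at hsum
  rw [Finset.sum_comm (f := fun i j => P j i), Finset.sum_comm (f := fun i j => B j i)] at hsum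
  linarith

/-- Directions of the framework `u ↦ e_{u mod d} + ε u (1, …, 1)`. At `ε = 0` this is the limit of
the directions as `ε → 0⁺`. -/
noncomputable def residueDirection {n d : ℕ} [NeZero d] (ε : ℝ) (u v : Fin n) (i : Fin d) : ℝ :=
  if residue d u = residue d v then -(√d)⁻¹
  else ((if i = residue d u then 1 else 0) - (if i = residue d v then 1 else 0) + ε * (u - v)) *
    (√(2 + d * (ε * (u - v)) ^ 2))⁻¹

theorem directionForm_residueDirection_zero {n d : ℕ} [NeZero d] (x : Fin n × Fin d → ℝ) :
    directionForm (residueDirection 0) x =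
      ∑ q ∈ pathEdges n d with residue d q.1 = residue d q.2,
        ((√d)⁻¹ * ∑ i, x (q.1, i) - (√d)⁻¹ * ∑ i, x (q.2, i)) ^ 2 +
      2⁻¹ * ∑ q ∈ pathEdges n d with residue d q.1 ≠ residue d q.2,
        ((x (q.1, residue d q.1) - x (q.1, residue d q.2)) -
          (x (q.2, residue d q.1) - x (q.2, residue d q.2))) ^ 2 := by
  rw [directionForm, ← Finset.sum_filter_add_sum_filter_not _
    (fun q : Fin n × Fin n => residue d q.1 = residue d q.2), Finset.mul_sum]
  congr 1
  · refine Finset.sum_congr rfl fun q hq => ?_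
    simp only [residueDirection, (Finset.mem_filter.1 hq).2, if_true, ← Finset.mul_sum,
      Finset.sum_sub_distrib]
    ring
  · refine Finset.sum_congr rfl fun q hq => ?_
    have hne := (Finset.mem_filter.1 hq).2
    simp only [residueDirection, if_neg hne, zero_mul, add_zero, zero_pow two_ne_zero, mul_zero]
    have e : ∑ i, ((if i = residue d q.1 then 1 else 0) -
          (if i = residue d q.2 then 1 else 0) : ℝ) * (√2)⁻¹ *
        (x (q.1, i) - x (q.2, i)) = (√2)⁻¹ * ((x (q.1, residue d q.1) - x (q.1, residue d q.2)) -
          (x (q.2, residue d q.1) - x (q.2, residue d q.2))) := by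
      have e1 : ∀ i, ((if i = residue d q.1 then 1 else 0) -
          (if i = residue d q.2 then 1 else 0) : ℝ) * (√2)⁻¹ *
        (x (q.1, i) - x (q.2, i)) = (√2)⁻¹ *
          ((if i = residue d q.1 then (x (q.1, i) - x (q.2, i)) else 0) -
           (if i = residue d q.2 then (x (q.1, i) - x (q.2, i)) else 0)) := by
        intro i
        split_ifs <;> ring
      simp only [e1, ← Finset.mul_sum, Finset.sum_sub_distrib, Finset.sum_ite_eq',
        Finset.mem_univ, if_true]
      ring
    rw [e, mul_pow, inv_pow, Real.sq_sqrt (by norm_num)]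

/-- The path inequalities reduce the claim to one vertex `u`: the class edges control the component
of `x u` along `(1, …, 1)`, and `hκ`, with `i` the class of `u`, controls the rest. -/
theorem directionForm_limit_ge {n d N : ℕ} [NeZero d] (hd : 2 ≤ d)
    (hN : ∀ i j : Fin d, i ≠ j → (residueSet n i ∪ residueSet n j).card ≤ N)
    {κ : ℝ} (hκ1 : κ ≤ 1)
    (hκ : ∀ (y : Fin d → ℝ) (i : Fin d),
      κ * (∑ j, y j ^ 2 - ((√d)⁻¹ * ∑ j, y j) ^ 2) ≤ 2⁻¹ * ∑ j, (y i - y j) ^ 2)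
    (x : Fin n × Fin d → ℝ)
    (hx0 : ∀ i : Fin d, ∑ u ∈ residueSet n i, ∑ k, x (u, k) = 0)
    (hx : ∀ i j : Fin d, i ≠ j →
      ∑ u ∈ residueSet n i ∪ residueSet n j, (x (u, i) - x (u, j)) = 0) :
    κ * (2 * (1 - Real.cos (Real.pi / N))) * (x ⬝ᵥ x) ≤
      directionForm (residueDirection 0) x := by
  rw [directionForm_residueDirection_zero]
  have hN' : ∀ i : Fin d, (residueSet n i).card ≤ N := by
    intro i
    have : Nontrivial (Fin d) := Fin.nontrivial_iff_two_le.2 hd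
    obtain ⟨j, hj⟩ := exists_ne i
    exact (Finset.card_le_card Finset.subset_union_left).trans (hN i j hj.symm)
  have h1 := sum_same_residue_ge hN' (fun u => (√d)⁻¹ * ∑ i, x (u, i))
    (fun i => by rw [← Finset.mul_sum, hx0, mul_zero])
  have h2 := sum_different_residue_ge hN x hx
  set lam := 2 * (1 - Real.cos (Real.pi / N)) with hlam
  have hlam0 : 0 ≤ lam := by
    have := Real.cos_le_one (Real.pi / N)
    rw [hlam]; linarith
  have h3 : κ * (x ⬝ᵥ x) ≤ ∑ u, ((√d)⁻¹ * ∑ i, x (u, i)) ^ 2 +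
      2⁻¹ * ∑ u, ∑ j, (x (u, residue d u) - x (u, j)) ^ 2 := by
    rw [dotProduct, Fintype.sum_prod_type, Finset.mul_sum, Finset.mul_sum,
      ← Finset.sum_add_distrib]
    refine Finset.sum_le_sum fun u _ => ?_
    have h := hκ (fun j => x (u, j)) (residue d u)
    have h' : κ * ((√d)⁻¹ * ∑ i, x (u, i)) ^ 2 ≤ ((√d)⁻¹ * ∑ i, x (u, i)) ^ 2 :=
      mul_le_of_le_one_left (sq_nonneg _) hκ1
    simp only [← sq]
    linarith
  have h4 := mul_le_mul_of_nonneg_left h3 hlam0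
  linarith

/-! ### Perturbation of the directions -/

/-- A crude estimate suffices: the factor is independent of `x` and continuous in the directions. -/
theorem directionForm_sub_le {n d : ℕ} (D D' : Fin n → Fin n → Fin d → ℝ)
    (x : Fin n × Fin d → ℝ) :
    directionForm D x - directionForm D' x ≤ (∑ q ∈ pathEdges n d, ∑ i, ∑ j,
      4 * |D q.1 q.2 i * D q.1 q.2 j - D' q.1 q.2 i * D' q.1 q.2 j|) * (x ⬝ᵥ x) := by
  have hle : ∀ a, x a ^ 2 ≤ x ⬝ᵥ x := fun a => by
    rw [sq]
    exact Finset.single_le_sum (f := fun a => x a * x a) (fun _ _ => mul_self_nonneg _)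
      (Finset.mem_univ a)
  rw [directionForm, directionForm, ← Finset.sum_sub_distrib, Finset.sum_mul]
  refine Finset.sum_le_sum fun q _ => ?_
  rw [sq, sq, Finset.sum_mul_sum, Finset.sum_mul_sum, ← Finset.sum_sub_distrib, Finset.sum_mul]
  refine Finset.sum_le_sum fun i _ => ?_
  rw [← Finset.sum_sub_distrib, Finset.sum_mul]
  refine Finset.sum_le_sum fun j _ => ?_
  set a := x (q.1, i) - x (q.2, i) with ha
  set b := x (q.1, j) - x (q.2, j) with hb
  have hab : |a * b| ≤ 4 * (x ⬝ᵥ x) := by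
    have h1 := hle (q.1, i)
    have h2 := hle (q.2, i)
    have h3 := hle (q.1, j)
    have h4 := hle (q.2, j)
    rw [abs_le]
    constructor
    · nlinarith [sq_nonneg (a + b), sq_nonneg (x (q.1, i) + x (q.2, i)),
        sq_nonneg (x (q.1, j) + x (q.2, j))]
    · nlinarith [sq_nonneg (a - b), sq_nonneg (x (q.1, i) + x (q.2, i)),
        sq_nonneg (x (q.1, j) + x (q.2, j))]
  calc _ = (D q.1 q.2 i * D q.1 q.2 j - D' q.1 q.2 i * D' q.1 q.2 j) * (a * b) := by ring
    _ ≤ |D q.1 q.2 i * D q.1 q.2 j - D' q.1 q.2 i * D' q.1 q.2 j| * |a * b| := by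
        rw [← abs_mul]; exact le_abs_self _
    _ ≤ |D q.1 q.2 i * D q.1 q.2 j - D' q.1 q.2 i * D' q.1 q.2 j| * (4 * (x ⬝ᵥ x)) :=
        mul_le_mul_of_nonneg_left hab (abs_nonneg _)
    _ = _ := by ring

theorem continuous_residueDirection {n d : ℕ} [NeZero d] (u v : Fin n) (i : Fin d) :
    Continuous fun ε => residueDirection ε u v i := by
  unfold residueDirection
  by_cases h : residue d u = residue d v
  · simp only [if_pos h]
    exact continuous_const
  · simp only [if_neg h]
    refine Continuous.mul (by fun_prop) (Continuous.inv₀ (by fun_prop) fun ε => ?_)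
    positivity

theorem exists_pos_directionForm_ge {n d : ℕ} [NeZero d] {η : ℝ} (hη : 0 < η) :
    ∃ ε : ℝ, 0 < ε ∧ ∀ x : Fin n × Fin d → ℝ,
      directionForm (residueDirection 0) x - η * (x ⬝ᵥ x) ≤
        directionForm (residueDirection ε) x := by
  let h : ℝ → ℝ := fun ε => ∑ q ∈ pathEdges n d, ∑ i : Fin d, ∑ j : Fin d,
    4 * |residueDirection 0 q.1 q.2 i * residueDirection 0 q.1 q.2 j -
      residueDirection ε q.1 q.2 i * residueDirection ε q.1 q.2 j|
  have hc : Continuous h := by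
    refine continuous_finsetSum _ fun q _ => continuous_finsetSum _ fun i _ =>
      continuous_finsetSum _ fun j _ => ?_
    have := continuous_residueDirection q.1 q.2 i
    have := continuous_residueDirection q.1 q.2 j
    fun_prop
  have h0 : h 0 = 0 := by simp [h]
  have hev : ∀ᶠ ε in nhds (0 : ℝ), h ε < η :=
    hc.continuousAt.eventually_lt continuousAt_const (by rw [h0]; exact hη)
  have hev' : ∀ᶠ ε in nhdsWithin (0 : ℝ) (Set.Ioi 0), h ε < η ∧ 0 < ε :=
    (hev.filter_mono nhdsWithin_le_nhds).and self_mem_nhdsWithin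
  obtain ⟨ε, hε, hpos⟩ := hev'.exists
  refine ⟨ε, hpos, fun x => ?_⟩
  have h1 := directionForm_sub_le (residueDirection 0) (residueDirection ε) x
  have h2 : 0 ≤ x ⬝ᵥ x := Finset.sum_nonneg fun _ _ => mul_self_nonneg _
  have h3 := mul_le_mul_of_nonneg_right hε.le h2
  simp only [h] at h3
  linarith

/-! ### The framework -/

/-- The framework `u ↦ e_{u mod d} + ε u (1, …, 1)`. -/
noncomputable def residueFramework (n d : ℕ) [NeZero d] (ε : ℝ) (u : Fin n) : EuclideanSpace ℝ (Fin d) :=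
  WithLp.toLp 2 fun i => (if i = residue d u then 1 else 0) + ε * u

theorem residueFramework_sub_apply {n d : ℕ} [NeZero d] (ε : ℝ) (u v : Fin n) (i : Fin d) :
    (residueFramework n d ε u - residueFramework n d ε v) i =
      (if i = residue d u then 1 else 0) - (if i = residue d v then 1 else 0) + ε * (u - v) := by
  simp only [residueFramework, PiLp.sub_apply]
  ring

theorem frameworkDirection_residueFramework {n d : ℕ} [NeZero d] {ε : ℝ} (hε : 0 < ε)
    {u v : Fin n} (huv : u < v) (i : Fin d) :
    frameworkDirection (residueFramework n d ε) u v i = residueDirection ε u v i := by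
  have huv' : ((u : ℕ) : ℝ) < (v : ℕ) := by exact_mod_cast huv
  have hd : (0 : ℝ) < d := by exact_mod_cast NeZero.pos d
  set w := residueFramework n d ε u - residueFramework n d ε v with hw
  have hwi := residueFramework_sub_apply (d := d) ε u v
  rw [← hw] at hwi
  have hdir : frameworkDirection (residueFramework n d ε) u v i = ‖w‖⁻¹ * w i := by
    unfold frameworkDirection
    split_ifs with h
    · rfl
    · have : w = 0 := by rw [hw, sub_eq_zero]; simpa using h
      simp [this]
  rw [hdir, residueDirection, EuclideanSpace.norm_eq]
  by_cases h : residue d u = residue d v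
  · rw [if_pos h]
    have e : ∀ j, w j = ε * (u - v) := fun j => by rw [hwi, h]; ring
    simp only [e, Real.norm_eq_abs, sq_abs, Finset.sum_const, Finset.card_univ, Fintype.card_fin,
      nsmul_eq_mul]
    have hneg : ε * ((u : ℝ) - v) < 0 := mul_neg_of_pos_of_neg hε (by linarith)
    rw [Real.sqrt_mul hd.le, Real.sqrt_sq_eq_abs, abs_of_neg hneg]
    have := Real.sqrt_pos.2 hd
    have hne : (u : ℝ) - v ≠ 0 := (sub_neg.2 huv').ne
    field_simp
  · rw [if_neg h, hwi, mul_comm]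
    congr 3
    set t := ε * ((u : ℝ) - v)
    -- The cross terms `2 * t` and `-2 * t` cancel in the sum, leaving `2 + d * t ^ 2`.
    have e : ∀ j, ‖w j‖ ^ 2 = ((if j = residue d u then 1 + 2 * t else 0) +
        (if j = residue d v then 1 - 2 * t else 0)) + t ^ 2 := by
      intro j
      rw [hwi, Real.norm_eq_abs, sq_abs]
      split_ifs with h1 h2
      · exact absurd (h1.symm.trans h2) h
      all_goals ring
    simp only [e, Finset.sum_add_distrib, Finset.sum_ite_eq', Finset.mem_univ, if_true,
      Finset.sum_const, Finset.card_univ, Fintype.card_fin, nsmul_eq_mul]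
    ring

theorem affineSpan_residueFramework {n d : ℕ} [NeZero d] (hn : d + 1 ≤ n) {ε : ℝ} (hε : 0 < ε) :
    affineSpan ℝ (Set.range (residueFramework n d ε)) = ⊤ := by
  have hd0 := NeZero.pos d
  have hd : (0 : ℝ) < d := by exact_mod_cast hd0
  have : Nonempty (Fin n) := ⟨⟨0, by omega⟩⟩
  rw [AffineSubspace.affineSpan_eq_top_iff_vectorSpan_eq_top_of_nonempty ℝ _ _
    (Set.range_nonempty _), ← Submodule.orthogonal_eq_bot_iff, Submodule.eq_bot_iff]
  intro a ha
  have hinner : ∀ u v : Fin n, a (residue d u) - a (residue d v) + ε * (u - v) * ∑ i, a i = 0 := by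
    intro u v
    have h := (Submodule.mem_orthogonal _ _).1 ha
      (residueFramework n d ε u - residueFramework n d ε v)
      (vsub_mem_vectorSpan ℝ (Set.mem_range_self u) (Set.mem_range_self v))
    rw [PiLp.inner_apply] at h
    simp only [residueFramework_sub_apply, RCLike.inner_apply, conj_trivial] at h
    rw [← h, Finset.mul_sum]
    have e : ∀ i, a i * ((if i = residue d u then 1 else 0) - (if i = residue d v then 1 else 0) +
        ε * ((u : ℝ) - v)) = ((if i = residue d u then a i else 0) -
        (if i = residue d v then a i else 0)) + ε * ((u : ℝ) - v) * a i := by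
      intro i
      split_ifs <;> ring
    simp only [e, Finset.sum_add_distrib, Finset.sum_sub_distrib, Finset.sum_ite_eq',
      Finset.mem_univ, if_true]
  let z : Fin d := ⟨0, hd0⟩
  have hres : ∀ i : Fin d, residue d (⟨i, by omega⟩ : Fin n) = i := fun i =>
    residue_eq_iff.2 (Nat.mod_eq_of_lt i.2)
  -- Vertices `0` and `d` share a class, so their difference is a multiple of `(1, …, 1)`; this is
  -- where `d + 1 ≤ n` enters.
  have hsum : ∑ i, a i = 0 := by
    have h := hinner ⟨d, by omega⟩ ⟨0, by omega⟩
    have e1 : residue d (⟨d, by omega⟩ : Fin n) = z := residue_eq_iff.2 (by simp [z])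
    have e2 : residue d (⟨0, by omega⟩ : Fin n) = z := residue_eq_iff.2 (by simp [z])
    rw [e1, e2] at h
    simpa [hε.ne', hd.ne'] using h
  have hconst : ∀ i, a i = a z := by
    intro i
    have h := hinner ⟨i, by omega⟩ ⟨z, by omega⟩
    rw [hsum, hres, hres] at h
    linarith
  have hz : a z = 0 := by
    rw [Finset.sum_congr rfl fun i _ => hconst i] at hsum
    simpa [hd.ne'] using hsum
  ext i
  rw [hconst, hz]; rfl

/-- The linear conditions under which the limit form is bounded below. -/
noncomputable def residueConstraints (n d : ℕ) [NeZero d] :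
    (Fin n × Fin d → ℝ) →ₗ[ℝ] (Sym2 (Fin d) → ℝ) :=
  LinearMap.pi fun e =>
    if (Quot.out e).1 = (Quot.out e).2 then
      ∑ u ∈ residueSet n (Quot.out e).1, ∑ k, LinearMap.proj (R := ℝ) (φ := fun _ => ℝ) (u, k)
    else
      ∑ u ∈ residueSet n (Quot.out e).1 ∪ residueSet n (Quot.out e).2,
        (LinearMap.proj (R := ℝ) (φ := fun _ => ℝ) (u, (Quot.out e).1) - LinearMap.proj (R := ℝ) (φ := fun _ => ℝ) (u, (Quot.out e).2))

theorem residueConstraints_eq_zero {n d : ℕ} [NeZero d] {x : Fin n × Fin d → ℝ}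
    (h : residueConstraints n d x = 0) :
    (∀ i : Fin d, ∑ u ∈ residueSet n i, ∑ k, x (u, k) = 0) ∧
    ∀ i j : Fin d, i ≠ j →
      ∑ u ∈ residueSet n i ∪ residueSet n j, (x (u, i) - x (u, j)) = 0 := by
  have hout : ∀ i j : Fin d, s((Quot.out s(i, j)).1, (Quot.out s(i, j)).2) = s(i, j) :=
    fun i j => Quot.out_eq _
  constructor
  · intro i
    have h1 := congrFun h s(i, i)
    have h2 := hout i i
    simp only [residueConstraints, LinearMap.pi_apply] at h1
    rw [Sym2.eq_iff] at h2
    obtain ⟨ha, hb⟩ : (Quot.out s(i, i)).1 = i ∧ (Quot.out s(i, i)).2 = i := by tauto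
    rw [ha, hb, if_pos rfl] at h1
    simpa using h1
  · intro i j hij
    have h1 := congrFun h s(i, j)
    have h2 := hout i j
    simp only [residueConstraints, LinearMap.pi_apply] at h1
    rw [Sym2.eq_iff] at h2
    rcases h2 with ⟨ha, hb⟩ | ⟨ha, hb⟩
    · rw [ha, hb, if_neg hij] at h1
      simpa using h1
    -- The representative chosen by `Quot.out` may be reversed, which only changes the sign of the
    -- constraint.
    · rw [ha, hb, if_neg hij.symm] at h1
      rw [Finset.union_comm, ← neg_eq_zero, ← Finset.sum_neg_distrib]
      simpa using h1

theorem choose_add_one_le {n d : ℕ} (hd : 2 ≤ d) (hn : d + 1 ≤ n) :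
    (d + 1).choose 2 + 1 ≤ n * d := by
  rw [Nat.choose_two_right, Nat.add_sub_cancel]
  have h1 : (d + 1) * d ≤ n * d := Nat.mul_le_mul_right d hn
  have h2 : 2 * 3 ≤ (d + 1) * d := by nlinarith
  omega

/-- A real `sSup` dominates the members of the set only once boundedness is known. -/
theorem bddAbove_smallestEigenvalue_generalizedPath {n d : ℕ} (hd : 2 ≤ d) (hn : d + 1 ≤ n) :
    BddAbove {x : ℝ | ∃ p : Fin n → EuclideanSpace ℝ (Fin d),
      affineSpan ℝ (Set.range p) = ⊤ ∧ x = smallestEigenvalue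
        (stiffnessMatrix_isHermitian (generalizedPath n d) p) ((d + 1).choose 2 + 1)} := by
  refine ⟨2 * (d : ℝ) - 2 * ∑ k ∈ Finset.Icc 1 d, Real.cos (2 * (k : ℝ) * Real.pi / (n : ℝ)), ?_⟩
  rintro _ ⟨p, hp, rfl⟩
  exact smallestEigenvalue_generalizedPath_le (by omega) (by omega) hp

theorem algebraicConnectivity_generalizedPath_ge {n d N : ℕ} [NeZero d] (hd : 2 ≤ d)
    (hn : d + 1 ≤ n)
    (hN : ∀ i j : Fin d, i ≠ j → (residueSet n i ∪ residueSet n j).card ≤ N)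
    {κ : ℝ} (hκ1 : κ ≤ 1)
    (hκ : ∀ (y : Fin d → ℝ) (i : Fin d),
      κ * (∑ j, y j ^ 2 - ((√d)⁻¹ * ∑ j, y j) ^ 2) ≤ 2⁻¹ * ∑ j, (y i - y j) ^ 2) :
    κ * (2 * (1 - Real.cos (Real.pi / N))) ≤ algebraicConnectivity d (generalizedPath n d) := by
  refine le_of_forall_sub_le fun η hη => ?_
  obtain ⟨ε, hε, h⟩ := exists_pos_directionForm_ge (n := n) (d := d) hη
  refine le_trans ?_ (le_csSup (bddAbove_smallestEigenvalue_generalizedPath hd hn)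
    ⟨residueFramework n d ε, affineSpan_residueFramework hn hε, rfl⟩)
  refine le_smallestEigenvalue_of_constraints _
    (by simpa using choose_add_one_le hd hn) (by simp [Sym2.card]) (residueConstraints n d) ?_
  intro x hx
  obtain ⟨h0, h1⟩ := residueConstraints_eq_zero hx
  have h2 := directionForm_limit_ge hd hN hκ1 hκ x h0 h1
  have h3 : x ⬝ᵥ stiffnessMatrix (generalizedPath n d) (residueFramework n d ε) *ᵥ x =
      directionForm (residueDirection ε) x := by
    rw [dotProduct_stiffnessMatrix_mulVec]
    refine Finset.sum_congr rfl fun q hq => ?_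
    have hlt := (Finset.mem_filter.1 hq).2.1
    simp only [frameworkDirection_residueFramework hε hlt]
  rw [h3, sub_mul]
  linarith [h x]

/-! ### Explicit bounds -/

/-- The sum of squared deviations from `y i` is smallest when `y i` is replaced by the mean. This
gives `κ = 1/2`; for `d = 2` the value `κ = 1` is possible. -/
theorem half_variance_le {d : ℕ} (hd : 0 < d) (y : Fin d → ℝ) (i : Fin d) :
    2⁻¹ * (∑ j, y j ^ 2 - ((√d)⁻¹ * ∑ j, y j) ^ 2) ≤ 2⁻¹ * ∑ j, (y i - y j) ^ 2 := by
  have hdR : (0 : ℝ) < d := by exact_mod_cast hd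
  have e : ∑ j, (y i - y j) ^ 2 = d * y i ^ 2 - 2 * y i * ∑ j, y j + ∑ j, y j ^ 2 := by
    simp only [sub_sq, Finset.sum_add_distrib, Finset.sum_sub_distrib, ← Finset.mul_sum,
      Finset.sum_const, Finset.card_univ, Fintype.card_fin, nsmul_eq_mul]
  rw [e, mul_pow, inv_pow, Real.sq_sqrt hdR.le]
  have h : 0 ≤ (d : ℝ)⁻¹ * (d * y i - ∑ j, y j) ^ 2 := by positivity
  have h2 : (d : ℝ)⁻¹ * (d * y i - ∑ j, y j) ^ 2 =
      d * y i ^ 2 - 2 * y i * ∑ j, y j + (d : ℝ)⁻¹ * (∑ j, y j) ^ 2 := by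
    field_simp
    ring
  linarith

theorem variance_le_of_two (y : Fin 2 → ℝ) (i : Fin 2) :
    1 * (∑ j, y j ^ 2 - ((√(2 : ℕ))⁻¹ * ∑ j, y j) ^ 2) ≤ 2⁻¹ * ∑ j, (y i - y j) ^ 2 := by
  rw [mul_pow, inv_pow, Real.sq_sqrt (Nat.cast_nonneg _)]
  fin_cases i <;> simp only [Fin.sum_univ_two] <;> norm_num <;> nlinarith

theorem algebraicConnectivity_generalizedPath_lower {n d : ℕ} (hd : 2 ≤ d) (hn : d + 1 ≤ n) :
    1 - Real.cos (Real.pi / 2 * (⌈(n : ℝ) / (d : ℝ)⌉₊ : ℝ)⁻¹) ≤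
      algebraicConnectivity d (generalizedPath n d) := by
  have : NeZero d := ⟨by omega⟩
  have h := algebraicConnectivity_generalizedPath_ge hd hn (N := 2 * ⌈(n : ℝ) / (d : ℝ)⌉₊)
    (fun i j _ => (Finset.card_union_le _ _).trans (by
      have := card_residueSet_le n i
      have := card_residueSet_le n j
      omega)) (by norm_num) (half_variance_le (by omega))
  refine le_trans (le_of_eq ?_) h
  have e : Real.pi / ((2 * ⌈(n : ℝ) / (d : ℝ)⌉₊ : ℕ) : ℝ) =
      Real.pi / 2 * (⌈(n : ℝ) / (d : ℝ)⌉₊ : ℝ)⁻¹ := by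
    push_cast
    rw [div_mul_eq_div_div, div_eq_mul_inv]
  rw [e]
  ring

theorem algebraicConnectivity_generalizedPath_two_lower {n : ℕ} (hn : 3 ≤ n) :
    2 * (1 - Real.cos (Real.pi / (n : ℝ))) ≤ algebraicConnectivity 2 (generalizedPath n 2) := by
  -- With two classes the union is contained in the whole vertex set, so `N = n` replaces `2⌈n/2⌉`.
  have h := algebraicConnectivity_generalizedPath_ge le_rfl hn (N := n)
    (fun i j _ => (Finset.card_le_univ _).trans (by simp)) le_rfl variance_le_of_two
  rwa [one_mul] at h

theorem algebraicConnectivity_generalizedPath_upper {n d : ℕ} (hd : 2 ≤ d) (hn : d + 1 ≤ n) :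
    algebraicConnectivity d (generalizedPath n d) ≤
      2 * (d : ℝ) - 2 * ∑ k ∈ Finset.Icc 1 d, Real.cos (2 * (k : ℝ) * Real.pi / (n : ℝ)) := by
  have : NeZero d := ⟨by omega⟩
  refine csSup_le ⟨_, residueFramework n d 1, affineSpan_residueFramework hn one_pos, rfl⟩ ?_
  rintro _ ⟨p, hp, rfl⟩
  exact smallestEigenvalue_generalizedPath_le (by omega) (by omega) hp

theorem half_div_sq_le {n d : ℕ} (hd : 1 ≤ d) (hn : 1 ≤ n) :
    1 / 2 * (1 / (n : ℝ) ^ 2) ≤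
      1 - Real.cos (Real.pi / 2 * (⌈(n : ℝ) / (d : ℝ)⌉₊ : ℝ)⁻¹) := by
  set M := ⌈(n : ℝ) / (d : ℝ)⌉₊
  have hdR : (1 : ℝ) ≤ d := by exact_mod_cast hd
  have hnR : (1 : ℝ) ≤ n := by exact_mod_cast hn
  have hM : 1 ≤ M := Nat.one_le_ceil_iff.2 (by positivity)
  have hMR : (1 : ℝ) ≤ M := by exact_mod_cast hM
  have hMn : (M : ℝ) ≤ n := by
    exact_mod_cast Nat.ceil_le.2 (div_le_self (by positivity) hdR)
  have hx0 : 0 ≤ Real.pi / 2 * (M : ℝ)⁻¹ := by positivity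
  have hx : |Real.pi / 2 * (M : ℝ)⁻¹| ≤ Real.pi := by
    rw [abs_of_nonneg hx0]
    have := inv_le_one_of_one_le₀ hMR
    nlinarith [Real.pi_pos]
  -- Here `cos x ≤ 1 - (2/π²) x²` at `x = π/(2M)` yields `1/(2M²)`, and `M ≤ n`; hence `c = 1/2` for
  -- every `d`.
  have h := Real.cos_le_one_sub_mul_cos_sq hx
  have e : 2 / Real.pi ^ 2 * (Real.pi / 2 * (M : ℝ)⁻¹) ^ 2 = 1 / 2 * (1 / (M : ℝ) ^ 2) := by
    have := Real.pi_pos.ne'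
    field_simp
  have h2 : 1 / (n : ℝ) ^ 2 ≤ 1 / (M : ℝ) ^ 2 := by gcongr
  linarith

theorem cosine_sum_le (n d : ℕ) :
    2 * (d : ℝ) - 2 * ∑ k ∈ Finset.Icc 1 d, Real.cos (2 * (k : ℝ) * Real.pi / (n : ℝ)) ≤
      (∑ k ∈ Finset.Icc 1 d, (2 * (k : ℝ) * Real.pi) ^ 2) * (1 / (n : ℝ) ^ 2) := by
  have e : 2 * (d : ℝ) - 2 * ∑ k ∈ Finset.Icc 1 d, Real.cos (2 * (k : ℝ) * Real.pi / (n : ℝ)) =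
      ∑ k ∈ Finset.Icc 1 d, (2 - 2 * Real.cos (2 * (k : ℝ) * Real.pi / (n : ℝ))) := by
    rw [Finset.sum_sub_distrib, ← Finset.mul_sum]
    simp
    ring
  rw [e, Finset.sum_mul]
  refine Finset.sum_le_sum fun k _ => ?_
  have h := Real.one_sub_sq_div_two_le_cos (x := 2 * (k : ℝ) * Real.pi / n)
  have e2 : (2 * (k : ℝ) * Real.pi / n) ^ 2 = (2 * (k : ℝ) * Real.pi) ^ 2 * (1 / (n : ℝ) ^ 2) := by
    rw [div_pow]; ring
  linarith

theorem proposition7p5 :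
    (∀ d n : ℕ, 2 ≤ d → d + 1 ≤ n →
      1 - Real.cos (Real.pi / 2 * (⌈(n : ℝ) / (d : ℝ)⌉₊ : ℝ)⁻¹)
          ≤ algebraicConnectivity d (generalizedPath n d) ∧
      algebraicConnectivity d (generalizedPath n d)
          ≤ 2 * (d : ℝ) - 2 * ∑ k ∈ Finset.Icc 1 d, Real.cos (2 * (k : ℝ) * Real.pi / (n : ℝ))) ∧
    (∀ n : ℕ, 3 ≤ n →
      2 * (1 - Real.cos (Real.pi / (n : ℝ))) ≤ algebraicConnectivity 2 (generalizedPath n 2)) ∧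
    (∀ d : ℕ, 2 ≤ d → ∃ c C : ℝ, 0 < c ∧ 0 < C ∧ ∀ n : ℕ, d + 1 ≤ n →
      c * (1 / (n : ℝ) ^ 2) ≤ algebraicConnectivity d (generalizedPath n d) ∧
      algebraicConnectivity d (generalizedPath n d) ≤ C * (1 / (n : ℝ) ^ 2)) := by
  refine ⟨fun d n hd hn => ⟨algebraicConnectivity_generalizedPath_lower hd hn,
    algebraicConnectivity_generalizedPath_upper hd hn⟩,
    fun n hn => algebraicConnectivity_generalizedPath_two_lower hn, fun d hd => ?_⟩
  refine ⟨1 / 2, ∑ k ∈ Finset.Icc 1 d, (2 * (k : ℝ) * Real.pi) ^ 2, by norm_num, ?_,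
    fun n hn => ⟨?_, ?_⟩⟩
  · refine Finset.sum_pos (fun k hk => ?_) ⟨1, Finset.mem_Icc.2 ⟨le_rfl, by omega⟩⟩
    have : 0 < k := (Finset.mem_Icc.1 hk).1
    positivity
  · exact (half_div_sq_le (by omega) (by omega)).trans
      (algebraicConnectivity_generalizedPath_lower hd hn)
  · exact (algebraicConnectivity_generalizedPath_upper hd hn).trans (cosine_sum_le n d)
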